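/- Banach algebras are complex, satisfy $\|ab\|\le\|a\|\,\|b\|$, and need not have an identity or any kind of approximate identity. Let $A$ be a Banach algebra and let $x\in A$ be real positive: there are a Banach algebra $B$ with an identity of norm $1$ and an isometric embedding of $A$ as a subalgebra of $B$ such that $\operatorname{Re}\varphi(x)\ge 0$ for every $\varphi\in B^*$ with $\|\varphi\|=\varphi(1_B)=1$. Let $x^{1/n}$ ($n\in\mathbb N$) be the principal roots of $x$; that is, $x^{1/1}=x$ and, for $n\ge 2$ and $r=1/n$, $$x^{r}=\frac{\sin (r\pi)}{\pi}\int_0^\infty s^{r-1}(s+x)^{-1}x\,ds\in A .$$ These form a bounded sequence in $A$. Fix a Banach limit $\mathrm{LIM}$ on $\ell^\infty$, and let $s(x)\in A^{**}$ be the support idempotent of $x$, $s(x)(f)=\mathrm{LIM}_n\, f(x^{1/n})$ for $f\in A^*$. Let $\mathrm{ba}(x)$ be the closed (not necessarily unital) subalgebra of $A$ generated by $x$. Then the following are equivalent: (i) $s(x)\in A$ (with $A$ regarded as a subspace of $A^{**}$); (ii) $xA$ is closed; (iii) $Ax$ is closed; (iv) $x$ is pseudo-invertible in $A$, that is, there is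 $y\in A$ with $xyx=x$; (v) $x$ is invertible in $\mathrm{ba}(x)$, that is, $\mathrm{ba}(x)$ has an identity and $x$ has an inverse in $\mathrm{ba}(x)$. Moreover, these conditions imply (vi) $0$ is isolated in, or absent from, the spectrum $\mathrm{Sp}_A(x)$ (computed in $A$ if $A$ has an identity, and in the unitization of $A$ otherwise). Finally, if $\mathrm{ba}(x)$ is semisimple (its Jacobson radical is $0$), then (i)--(vi) are equivalent. -/

import Mathlib

universe u

open scoped Topology BoundedContinuousFunction ENNReal ComplexOrder

namespace RealPos

noncomputable section

/-! ### States, numerical range, real positive elements -/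

/-- A state of a unital Banach algebra: a norm one functional that takes the value `1` at `1`. -/
def IsState {B : Type u} [NormedRing B] [NormedAlgebra ℂ B] (f : StrongDual ℂ B) : Prop :=
  ‖f‖ = 1 ∧ f 1 = 1

/-- The numerical range of an element of a unital Banach algebra. -/
def numericalRange {B : Type u} [NormedRing B] [NormedAlgebra ℂ B] (b : B) : Set ℂ :=
  {z | ∃ f : StrongDual ℂ B, IsState f ∧ f b = z}

/-- The elements of `A` whose numerical range, computed in the unital algebra `B` into which `A`
is mapped by `φ`, lies in the closed right half-plane. -/
def realPositiveIn {A B : Type u} [NonUnitalNormedRing A] [NormedSpace ℂ A]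
    [NormedRing B] [NormedAlgebra ℂ B] (φ : A →ₙₐ[ℂ] B) : Set A :=
  {a | ∀ z ∈ numericalRange (φ a), 0 ≤ z.re}

/-- The real positive elements of a Banach algebra `A`: the union of the sets `realPositiveIn φ`
over all isometric embeddings `φ` of `A` as a subalgebra of a Banach algebra `B` with an identity
of norm `1`. (Replacing `B` by the subalgebra spanned by `φ A` and `1` changes neither the norm nor
the numerical range, so nothing is lost by taking `B` in the universe of `A`.) -/
def realPositive (A : Type u) [NonUnitalNormedRing A] [NormedSpace ℂ A] : Set A :=
  {a | ∃ (B : Type u) (_ : NormedRing B) (_ : NormedAlgebra ℂ B) (_ : NormOneClass B)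
    (_ : CompleteSpace B) (φ : A →ₙₐ[ℂ] B), Isometry φ ∧ a ∈ realPositiveIn φ}

/-! ### Fractional powers and roots -/

section Powers

variable {A : Type u} [NonUnitalNormedRing A] [NormedSpace ℂ A] [IsScalarTower ℂ A A]
  [SMulCommClass ℂ A A]

/-- The element `(s + x)⁻¹ x` of `A`, computed in the unitization of `A`. -/
def resolventMul (x : A) (s : ℝ) : A :=
  (Ring.inverse (algebraMap ℂ (Unitization ℂ A) (s : ℂ) + (x : Unitization ℂ A)) *
    (x : Unitization ℂ A)).snd

/-- The principal power `x ^ r` for `0 < r < 1`, given by the Balakrishnan formula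
`x ^ r = (sin (r π) / π) ∫₀^∞ s ^ (r - 1) (s + x)⁻¹ x ds`. -/
def fracPow (x : A) (r : ℝ) : A :=
  (Real.sin (r * Real.pi) / Real.pi) •
    ∫ s in Set.Ioi (0 : ℝ), (s ^ (r - 1)) • resolventMul x s

/-- The principal root `x ^ (1 / n)`, for `n ≥ 1`. -/
def nthRoot (x : A) (n : ℕ) : A :=
  if n = 1 then x else fracPow x (1 / (n : ℝ))

/-! #### The roots of a real positive element are bounded -/

theorem norm_le_of_accretive {B : Type u} [NormedRing B] [NormedAlgebra ℂ B] [NormOneClass B]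
    {y : B} (hy : ∀ z ∈ numericalRange y, 0 ≤ z.re) {s : ℝ} (c : B) :
    s * ‖c‖ ≤ ‖(algebraMap ℂ B (s : ℂ) + y) * c‖ := by
  rcases eq_or_ne c 0 with rfl | hc
  · simp
  have hc' : 0 < ‖c‖ := norm_pos_iff.mpr hc
  obtain ⟨g, hg, hgc'⟩ := exists_dual_vector ℂ c hc'.ne'
  have hgc : g c = (‖c‖ : ℂ) := hgc'
  let f : StrongDual ℂ B := ((‖c‖ : ℂ)⁻¹) • (g.comp ((ContinuousLinearMap.mul ℂ B).flip c))
  have hfa : ∀ b, f b = (‖c‖ : ℂ)⁻¹ * g (b * c) := fun b => rfl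
  have hcC : (‖c‖ : ℂ) ≠ 0 := by exact_mod_cast hc'.ne'
  have hf1 : f 1 = 1 := by
    rw [hfa, one_mul, hgc]
    exact inv_mul_cancel₀ hcC
  have hle : ‖f‖ ≤ 1 := by
    refine ContinuousLinearMap.opNorm_le_bound _ zero_le_one fun b => ?_
    rw [hfa, norm_mul, norm_inv, Complex.norm_real, norm_norm, one_mul, inv_mul_le_iff₀ hc']
    calc ‖g (b * c)‖ ≤ ‖g‖ * ‖b * c‖ := g.le_opNorm _
      _ = ‖b * c‖ := by rw [hg, one_mul]
      _ ≤ ‖b‖ * ‖c‖ := norm_mul_le _ _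
      _ = ‖c‖ * ‖b‖ := mul_comm _ _
  have hge : 1 ≤ ‖f‖ := by
    have := f.le_opNorm 1
    simpa [hf1] using this
  have hre := hy (f y) ⟨f, ⟨le_antisymm hle hge, hf1⟩, rfl⟩
  have hval : g ((algebraMap ℂ B (s : ℂ) + y) * c) = ‖c‖ * ((s : ℂ) + f y) := by
    rw [hfa, add_mul, map_add, ← Algebra.smul_def, map_smul, hgc, mul_add, mul_inv_cancel_left₀ hcC,
      smul_eq_mul, mul_comm (s : ℂ)]
  calc s * ‖c‖ ≤ ‖c‖ * (s + (f y).re) := by nlinarith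
    _ = (g ((algebraMap ℂ B (s : ℂ) + y) * c)).re := by
        rw [hval, Complex.re_ofReal_mul]; simp
    _ ≤ ‖g ((algebraMap ℂ B (s : ℂ) + y) * c)‖ := Complex.re_le_norm _
    _ ≤ ‖g‖ * ‖(algebraMap ℂ B (s : ℂ) + y) * c‖ := g.le_opNorm _
    _ = ‖(algebraMap ℂ B (s : ℂ) + y) * c‖ := by rw [hg, one_mul]

theorem isUnit_one_add_inr [CompleteSpace A] {b : A} (hb : ‖b‖ < 1) :
    IsUnit (1 + (b : Unitization ℂ A)) := by
  let e := WithLp.unitizationAlgEquiv (𝕜 := ℂ) (A := A) ℂ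
  have h : IsUnit (1 - WithLp.toLp 1 ((-b : A) : Unitization ℂ A)) := by
    apply isUnit_one_sub_of_norm_lt_one
    rw [WithLp.unitization_norm_inr, norm_neg]
    exact hb
  have h2 : IsUnit (1 - ((-b : A) : Unitization ℂ A)) := h.map e
  rwa [Unitization.inr_neg, sub_neg_eq_add] at h2

theorem inr_resolventMul {x : A} {s : ℝ}
    (h : IsUnit (algebraMap ℂ (Unitization ℂ A) (s : ℂ) + (x : Unitization ℂ A))) :
    (algebraMap ℂ (Unitization ℂ A) (s : ℂ) + (x : Unitization ℂ A)) *
      ((resolventMul x s : A) : Unitization ℂ A) = (x : Unitization ℂ A) := by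
  have h0 : ((resolventMul x s : A) : Unitization ℂ A) =
      Ring.inverse (algebraMap ℂ (Unitization ℂ A) (s : ℂ) + (x : Unitization ℂ A)) *
        (x : Unitization ℂ A) := by
    apply Unitization.ext
    · rw [Unitization.fst_inr, Unitization.fst_mul, Unitization.fst_inr, mul_zero]
    · rfl
  rw [h0, Ring.mul_inverse_cancel_left _ _ h]

theorem norm_resolventMul_of_isUnit {B : Type u} [NormedRing B] [NormedAlgebra ℂ B]
    [NormOneClass B] (φ : A →ₙₐ[ℂ] B) (hφ : Isometry φ) {x : A} (hx : x ∈ realPositiveIn φ)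
    {s : ℝ} (hs : 0 < s)
    (h : IsUnit (algebraMap ℂ (Unitization ℂ A) (s : ℂ) + (x : Unitization ℂ A))) :
    ‖resolventMul x s‖ ≤ 2 ∧ ‖resolventMul x s‖ ≤ ‖x‖ / s := by
  have hn : ∀ a, ‖φ a‖ = ‖a‖ := fun a => hφ.norm_map_of_map_zero (map_zero φ) a
  have key := congrArg (Unitization.lift φ) (inr_resolventMul h)
  have hl : ∀ a : A, Unitization.lift φ (a : Unitization ℂ A) = φ a := fun a =>
    DFunLike.congr_fun (Unitization.lift.symm_apply_apply φ) a
  rw [map_mul, map_add, AlgHom.commutes, hl, hl] at key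
  constructor
  · have h1 := norm_le_of_accretive hx (s := s) (1 - φ (resolventMul x s))
    rw [mul_sub, key, mul_one, add_sub_cancel_right, norm_algebraMap', Complex.norm_real,
      Real.norm_of_nonneg hs.le] at h1
    have h2 : ‖1 - φ (resolventMul x s)‖ ≤ 1 := by
      by_contra hlt
      push Not at hlt
      nlinarith
    have h3 := norm_sub_le (1 : B) (1 - φ (resolventMul x s))
    rw [sub_sub_cancel, norm_one, hn] at h3
    linarith
  · have h1 := norm_le_of_accretive hx (s := s) (φ (resolventMul x s))
    rw [key, hn, hn] at h1
    rw [le_div_iff₀ hs]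
    linarith

theorem isUnit_add_of_realPositive [CompleteSpace A] {x : A} (hx : x ∈ realPositive A)
    {s : ℝ} (hs : 0 < s) :
    IsUnit (algebraMap ℂ (Unitization ℂ A) (s : ℂ) + (x : Unitization ℂ A)) := by
  obtain ⟨B, _, _, _, _, φ, hφ, hxφ⟩ := hx
  have hsmul : ∀ (t : ℝ) (w : Unitization ℂ A), 0 < t → IsUnit w →
      IsUnit (algebraMap ℂ (Unitization ℂ A) (t : ℂ) * w) := fun t w ht hw =>
    ((IsUnit.mk0 (t : ℂ) (by exact_mod_cast ht.ne')).map _).mul hw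
  have main : ∀ (n : ℕ) (s : ℝ), 0 < s → ‖x‖ < (4 / 3 : ℝ) ^ n * s →
      IsUnit (algebraMap ℂ (Unitization ℂ A) (s : ℂ) + (x : Unitization ℂ A)) := by
    intro n
    induction n with
    | zero =>
      intro s hs hlt
      have hsC : (s : ℂ) ≠ 0 := by exact_mod_cast hs.ne'
      have hb : ‖((s : ℂ)⁻¹) • x‖ < 1 := by
        rw [norm_smul, norm_inv, Complex.norm_real, Real.norm_of_nonneg hs.le,
          inv_mul_lt_iff₀ hs]
        simpa using hlt
      have := hsmul s _ hs (isUnit_one_add_inr hb)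
      rwa [mul_add, mul_one, Unitization.algebraMap_eq_inl, Unitization.inl_mul_inr,
        smul_smul, mul_inv_cancel₀ hsC, one_smul] at this
    | succ n ih =>
      intro s hs hlt
      have ht : 0 < 4 / 3 * s := by positivity
      have hu := ih (4 / 3 * s) ht (by rw [pow_succ] at hlt; linarith)
      have hb := (norm_resolventMul_of_isUnit φ hφ hxφ ht hu).1
      have hr := inr_resolventMul hu
      set b := resolventMul x (4 / 3 * s) with hbdef
      have hb' : ‖((1 / 3 : ℂ)) • b‖ < 1 := by
        rw [norm_smul]
        norm_num
        linarith
      have h2 := hsmul (3 / 4) _ (by norm_num) (hu.mul (isUnit_one_add_inr hb'))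
      have heq : algebraMap ℂ (Unitization ℂ A) ((3 / 4 : ℝ) : ℂ) *
          ((algebraMap ℂ (Unitization ℂ A) ((4 / 3 * s : ℝ) : ℂ) + (x : Unitization ℂ A)) *
            (1 + (((1 / 3 : ℂ) • b : A) : Unitization ℂ A))) =
          algebraMap ℂ (Unitization ℂ A) (s : ℂ) + (x : Unitization ℂ A) := by
        have hcomm : (algebraMap ℂ (Unitization ℂ A) ((4 / 3 * s : ℝ) : ℂ) +
            (x : Unitization ℂ A)) * (((1 / 3 : ℂ) • b : A) : Unitization ℂ A) =
            (((1 / 3 : ℂ) • x : A) : Unitization ℂ A) := by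
          rw [← Unitization.inl_mul_inr, ← Unitization.inl_mul_inr, ← mul_assoc,
            ← Unitization.algebraMap_eq_inl, ← Algebra.commutes (1 / 3 : ℂ), mul_assoc, hr]
        rw [mul_add, mul_one, hcomm]
        apply Unitization.ext
        · simp [Unitization.algebraMap_eq_inl]
          ring
        · simp [Unitization.algebraMap_eq_inl]
          module
      rwa [heq] at h2
  obtain ⟨n, hn⟩ := pow_unbounded_of_one_lt (‖x‖ / s) (by norm_num : (1 : ℝ) < 4 / 3)
  exact main n s hs (by rwa [div_lt_iff₀ hs] at hn)

theorem norm_resolventMul_le [CompleteSpace A] {x : A} (hx : x ∈ realPositive A)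
    {s : ℝ} (hs : 0 < s) : ‖resolventMul x s‖ ≤ 2 ∧ ‖resolventMul x s‖ ≤ ‖x‖ / s := by
  have hu := isUnit_add_of_realPositive hx hs
  obtain ⟨B, _, _, _, _, φ, hφ, hxφ⟩ := hx
  exact norm_resolventMul_of_isUnit φ hφ hxφ hs hu

theorem norm_fracPow_le [CompleteSpace A] {x : A} (hx : x ∈ realPositive A)
    {r : ℝ} (hr0 : 0 < r) (hr : r ≤ 1 / 2) : ‖fracPow x r‖ ≤ 2 + ‖x‖ := by
  let g : ℝ → ℝ := fun s => if s ≤ 1 then 2 * s ^ (r - 1) else ‖x‖ * s ^ (r - 2)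
  have hi1 : MeasureTheory.IntegrableOn (fun s : ℝ => 2 * s ^ (r - 1)) (Set.Ioc 0 1) := by
    have := intervalIntegral.intervalIntegrable_rpow' (a := 0) (b := 1) (r := r - 1) (by linarith)
    rw [intervalIntegrable_iff_integrableOn_Ioc_of_le zero_le_one] at this
    exact this.const_mul 2
  have hi2 : MeasureTheory.IntegrableOn (fun s : ℝ => ‖x‖ * s ^ (r - 2)) (Set.Ioi 1) :=
    (integrableOn_Ioi_rpow_of_lt (by linarith) one_pos).const_mul _
  have hg1 : MeasureTheory.IntegrableOn g (Set.Ioc 0 1) :=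
    hi1.congr_fun (fun s hs => by simp [g, hs.2]) measurableSet_Ioc
  have hg2 : MeasureTheory.IntegrableOn g (Set.Ioi 1) :=
    hi2.congr_fun (fun s hs => by simp [g, not_le.mpr (Set.mem_Ioi.mp hs)]) measurableSet_Ioi
  have hg : MeasureTheory.IntegrableOn g (Set.Ioi 0) := by
    rw [← Set.Ioc_union_Ioi_eq_Ioi (zero_le_one (α := ℝ))]
    exact hg1.union hg2
  have e1 : ∫ s in Set.Ioc (0 : ℝ) 1, g s = 2 / r := by
    rw [MeasureTheory.setIntegral_congr_fun (g := fun s : ℝ => 2 * s ^ (r - 1)) measurableSet_Ioc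
      (fun s hs => by simp [g, hs.2]), ← intervalIntegral.integral_of_le zero_le_one,
      intervalIntegral.integral_const_mul, integral_rpow (Or.inl (by linarith))]
    simp [hr0.ne']
    ring
  have e2 : ∫ s in Set.Ioi (1 : ℝ), g s = ‖x‖ / (1 - r) := by
    rw [MeasureTheory.setIntegral_congr_fun (g := fun s : ℝ => ‖x‖ * s ^ (r - 2))
      measurableSet_Ioi (fun s hs => by simp [g, not_le.mpr (Set.mem_Ioi.mp hs)]),
      MeasureTheory.integral_const_mul, integral_Ioi_rpow_of_lt (by linarith) one_pos,
      Real.one_rpow, show r - 2 + 1 = -(1 - r) by ring, neg_div_neg_eq, mul_one_div]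
  have e : ∫ s in Set.Ioi (0 : ℝ), g s = 2 / r + ‖x‖ / (1 - r) := by
    rw [← Set.Ioc_union_Ioi_eq_Ioi (zero_le_one (α := ℝ)),
      MeasureTheory.setIntegral_union (Set.Ioc_disjoint_Ioi le_rfl) measurableSet_Ioi hg1 hg2,
      e1, e2]
  have hint : ‖∫ s in Set.Ioi (0 : ℝ), (s ^ (r - 1)) • resolventMul x s‖ ≤
      2 / r + ‖x‖ / (1 - r) := by
    rw [← e]
    refine MeasureTheory.norm_integral_le_of_norm_le hg ?_
    refine (MeasureTheory.ae_restrict_iff' measurableSet_Ioi).mpr (Filter.Eventually.of_forall ?_)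
    intro s hs
    have hs0 : 0 < s := hs
    obtain ⟨hb1, hb2⟩ := norm_resolventMul_le hx hs0
    have hp : 0 < s ^ (r - 1) := Real.rpow_pos_of_pos hs0 _
    rw [norm_smul, Real.norm_of_nonneg hp.le]
    by_cases h1 : s ≤ 1
    · simp only [g, h1, if_true]
      nlinarith
    · simp only [g, h1, if_false]
      calc s ^ (r - 1) * ‖resolventMul x s‖ ≤ s ^ (r - 1) * (‖x‖ / s) := by gcongr
        _ = ‖x‖ * s ^ (r - 2) := by
          rw [show r - 2 = (r - 1) - 1 by ring, Real.rpow_sub_one hs0.ne' (r - 1)]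
          field_simp
  have hpi := Real.pi_pos
  have hsin0 : 0 ≤ Real.sin (r * Real.pi) :=
    Real.sin_nonneg_of_nonneg_of_le_pi (by positivity) (by nlinarith)
  have hsin : Real.sin (r * Real.pi) / Real.pi ≤ r := by
    rw [div_le_iff₀ hpi]
    exact Real.sin_le (by positivity)
  have h1r : 0 < 1 - r := by linarith
  rw [fracPow, norm_smul, Real.norm_of_nonneg (by positivity)]
  calc Real.sin (r * Real.pi) / Real.pi * ‖∫ s in Set.Ioi (0 : ℝ), (s ^ (r - 1)) • resolventMul x s‖
      ≤ r * (2 / r + ‖x‖ / (1 - r)) := by gcongr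
    _ = 2 + ‖x‖ * (r / (1 - r)) := by field_simp
    _ ≤ 2 + ‖x‖ * 1 := by
        gcongr
        rw [div_le_one h1r]
        linarith
    _ = 2 + ‖x‖ := by ring

theorem norm_nthRoot_le [CompleteSpace A] {x : A} (hx : x ∈ realPositive A) (k : ℕ) :
    ‖nthRoot x (k + 1)‖ ≤ 2 + ‖x‖ := by
  unfold nthRoot
  split_ifs with h
  · linarith
  · have hk : 1 ≤ k := by omega
    have hk' : (1 : ℝ) ≤ k := by exact_mod_cast hk
    refine norm_fracPow_le hx (by positivity) ?_
    push_cast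
    rw [div_le_div_iff₀ (by positivity) (by norm_num)]
    linarith

end Powers

/-! ### Banach limits and the support idempotent -/

/-- The left shift of a bounded sequence. -/
def shift (v : ℕ →ᵇ ℂ) : ℕ →ᵇ ℂ :=
  v.compContinuous ⟨Nat.succ, continuous_of_discreteTopology⟩

/-- `L` is a Banach limit on the space `ℓ^∞` of bounded complex sequences. -/
structure IsBanachLimit (L : StrongDual ℂ (ℕ →ᵇ ℂ)) : Prop where
  norm_eq_one : ‖L‖ = 1
  nonneg : ∀ v : ℕ →ᵇ ℂ, (∀ n, 0 ≤ v n) → 0 ≤ L v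
  shift_eq : ∀ v : ℕ →ᵇ ℂ, L (shift v) = L v
  eq_lim : ∀ (v : ℕ →ᵇ ℂ) (z : ℂ), Filter.Tendsto (fun n => v n) Filter.atTop (𝓝 z) → L v = z

section Support

variable {A : Type u} [NonUnitalNormedRing A] [NormedSpace ℂ A] [IsScalarTower ℂ A A]
  [SMulCommClass ℂ A A] [CompleteSpace A]

/-- The bounded sequence `f (x ^ (1 / n))`, `n = 1, 2, 3, …`. -/
def rootSeq {x : A} (hx : x ∈ realPositive A) (f : StrongDual ℂ A) : ℕ →ᵇ ℂ :=
  BoundedContinuousFunction.ofNormedAddCommGroupDiscrete (fun k => f (nthRoot x (k + 1)))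
    (‖f‖ * (2 + ‖x‖)) fun k =>
      (f.le_opNorm _).trans (mul_le_mul_of_nonneg_left (norm_nthRoot_le hx k) (norm_nonneg f))

/-- The support idempotent `s(x) ∈ A**` of a real positive element, with respect to the Banach
limit `L`: the functional `f ↦ LIM_n f (x ^ (1 / n))` on `A*`. -/
def support (L : StrongDual ℂ (ℕ →ᵇ ℂ)) {x : A} (hx : x ∈ realPositive A) :
    StrongDual ℂ (StrongDual ℂ A) :=
  LinearMap.mkContinuous
    { toFun := fun f => L (rootSeq hx f)
      map_add' := fun f g => by
        rw [← map_add]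
        rfl
      map_smul' := fun c f => by
        rw [RingHom.id_apply, ← map_smul]
        rfl }
    (‖L‖ * (2 + ‖x‖)) fun f => by
      refine (L.le_opNorm _).trans ?_
      rw [mul_assoc]
      refine mul_le_mul_of_nonneg_left ?_ (norm_nonneg L)
      refine (BoundedContinuousFunction.norm_le (by positivity)).mpr fun k => ?_
      rw [mul_comm]
      exact (f.le_opNorm _).trans
        (mul_le_mul_of_nonneg_left (norm_nthRoot_le hx k) (norm_nonneg f))

end Support

/-! ### Algebraic notions -/

/-- `e` is a two-sided identity of the (possibly zero) ring `R`. -/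
def IsIdentity {R : Type u} [NonUnitalRing R] (e : R) : Prop :=
  ∀ a : R, e * a = a ∧ a * e = a

/-- `x` is invertible in `R`: there is an identity in `R`, and `x` has a two-sided inverse. -/
def IsInvertible {R : Type u} [NonUnitalRing R] (x : R) : Prop :=
  ∃ e y : R, IsIdentity e ∧ x * y = e ∧ y * x = e

/-- `x` is pseudo-invertible in `R`. -/
def IsPseudoInvertible {R : Type u} [NonUnitalRing R] (x : R) : Prop :=
  ∃ y : R, x * y * x = x

/-- The ring `R` (possibly without identity) is semisimple: its Jacobson radical, which consists
of all `a` such that every element of the left ideal `R a` is quasiregular, is zero. -/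
def IsSemisimple (R : Type u) [NonUnitalRing R] : Prop :=
  ∀ a : R, (∀ b : R, IsQuasiregular (b * a)) → a = 0

/-- The spectrum of `x` in `A`: if `A` has an identity `e` it is the set of all `z` for which
`z e - x` is not invertible in `A`, otherwise it is the spectrum in the unitization of `A`. -/
def Sp {A : Type u} [NonUnitalRing A] [Module ℂ A] [IsScalarTower ℂ A A] [SMulCommClass ℂ A A]
    (x : A) : Set ℂ :=
  {z | (∃ e : A, IsIdentity e ∧ ¬ IsInvertible (z • e - x)) ∨
    ((¬ ∃ e : A, IsIdentity e) ∧ z ∈ spectrum ℂ (x : Unitization ℂ A))}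

/-- `0` is an isolated point of, or does not belong to, the set `S`. -/
def ZeroIsolatedOrAbsent (S : Set ℂ) : Prop :=
  (∃ ε > 0, S ∩ Metric.ball 0 ε = {0}) ∨ (0 : ℂ) ∉ S

/-- `ba(x)`: the closed (not necessarily unital) subalgebra generated by `x`. -/
abbrev ba {A : Type u} [NonUnitalNormedRing A] [NormedSpace ℂ A] [IsScalarTower ℂ A A]
    [SMulCommClass ℂ A A] (x : A) : NonUnitalSubalgebra ℂ A :=
  NonUnitalAlgebra.elemental ℂ x

end

end RealPos

namespace RealPos

noncomputable section

variable {A : Type u} [NonUnitalNormedRing A] [NormedSpace ℂ A] [IsScalarTower ℂ A A]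
  [SMulCommClass ℂ A A]

/-! ### The closed subalgebra generated by one element -/

/-! Everything turns on whether `ba x` contains some e with x e = x. Such an e is an identity of `ba
x`, and x is then invertible there: e is a limit of polynomials in x without constant term, each of
the form x q with q in `ba x`, and an x q within distance 1 of e is invertible.

The analytic input is accretivity, s‖a‖ ≤ ‖s a + x a‖. For s > 0 the elements u_s = (s + x)⁻¹x lie
in `ba x`, have norm at most 2 and satisfy x - x u_s = s u_s, so x u_s → x as s → 0. If xA is
closed, it contains `ba x`, and the open mapping theorem writes each j in `ba x` as x b with ‖b‖ ≤
K‖j‖. Then j - u_s j = s u_s b is small relative to j, so multiplication by u_s is invertible on `ba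
x`, and the preimage of u_s is the required e. The case of Ax is symmetric, and a pseudo-inverse
makes both ranges closed. Averaging the u_s in the Balakrishnan formula gives x x^{1/n} → x; hence
s(x), if it lies in A, is such an e, and conversely an inverse of x in `ba x` makes the roots
converge in norm to the identity.

For the spectrum, an inverse y of x in `ba x` turns the inverse of 1 - z y into one of z - x for
small z ≠ 0. Conversely, if 0 is isolated, g(z) = (z - x)⁻¹x is holomorphic on a punctured disc. It
takes values in `ba x` on the negative axis, hence everywhere by the identity theorem. Every
character kills ∮ g, so semisimplicity gives ∮ g = 0, and then -(2πi)⁻¹ ∮ z⁻¹ g(z) dz is the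
required e. If 0 is absent from the spectrum, x is invertible in A, hence pseudo-invertible. -/

instance ba.normedSpace (x : A) : NormedSpace ℂ (ba x) :=
  Submodule.normedSpace (ba x).toSubmodule

theorem self_mem_ba (x : A) : x ∈ ba x := NonUnitalAlgebra.elemental.self_mem ℂ x

theorem ba_isClosed (x : A) : IsClosed (ba x : Set A) := NonUnitalAlgebra.elemental.isClosed ℂ x

theorem ba_mul_comm {x a b : A} (ha : a ∈ ba x) (hb : b ∈ ba x) : a * b = b * a :=
  congrArg Subtype.val (mul_comm (⟨a, ha⟩ : ba x) ⟨b, hb⟩)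

/-- The elements fixed by right multiplication by e form a closed subalgebra. -/
theorem mul_right_identity_of_mem_ba {x e : A} (he : x * e = x) {a : A} (ha : a ∈ ba x) :
    a * e = a := by
  let S : NonUnitalSubalgebra ℂ A :=
    { carrier := {a | a * e = a}
      add_mem' := fun {a b} (ha : a * e = a) (hb : b * e = b) => by
        change (a + b) * e = a + b
        rw [add_mul, ha, hb]
      zero_mem' := zero_mul e
      mul_mem' := fun {a b} _ (hb : b * e = b) => by
        change a * b * e = a * b
        rw [mul_assoc, hb]
      smul_mem' := fun c a (ha : a * e = a) => by
        change (c • a) * e = c • a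
        rw [smul_mul_assoc, ha] }
  have hS : IsClosed (S : Set A) :=
    isClosed_eq (continuous_id.mul continuous_const) continuous_id
  exact NonUnitalAlgebra.elemental.le_of_mem hS (show x ∈ S from he) ha

/-- If `ba x` has an identity then every element of the algebra generated by `x` is a multiple
of `x`. -/
theorem exists_eq_mul_of_mem_adjoin {x e : A} (he : e ∈ ba x) (hxe : x * e = x) {p : A}
    (hp : p ∈ NonUnitalAlgebra.adjoin ℂ {x}) : ∃ q ∈ ba x, p = x * q := by
  induction hp using NonUnitalAlgebra.adjoin_induction with
  | mem y hy => exact ⟨e, he, by rw [Set.mem_singleton_iff.mp hy, hxe]⟩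
  | add a b _ _ ha hb =>
    obtain ⟨q, hq, rfl⟩ := ha
    obtain ⟨r, hr, rfl⟩ := hb
    exact ⟨q + r, add_mem hq hr, (mul_add _ _ _).symm⟩
  | zero => exact ⟨0, zero_mem _, (mul_zero _).symm⟩
  | mul a b _ _ ha hb =>
    obtain ⟨q, hq, rfl⟩ := ha
    obtain ⟨r, hr, rfl⟩ := hb
    exact ⟨q * (x * r), mul_mem hq (mul_mem (self_mem_ba x) hr), mul_assoc _ _ _⟩
  | smul c a _ ha =>
    obtain ⟨q, hq, rfl⟩ := ha
    exact ⟨c • q, SMulMemClass.smul_mem c hq, (mul_smul_comm _ _ _).symm⟩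

variable [CompleteSpace A]

theorem isQuasiregular_of_norm_lt_one {b : A} (hb : ‖b‖ < 1) : IsQuasiregular b :=
  (isQuasiregular_iff_isUnit' ℂ).mpr (isUnit_one_add_inr hb)

/-- If `ba x` has an identity then `x` is invertible in `ba x`. -/
theorem isInvertible_of_identity {x e : A} (he : e ∈ ba x) (hxe : x * e = x) :
    IsInvertible (⟨x, self_mem_ba x⟩ : ba x) := by
  have hid : ∀ a : ba x, a * ⟨e, he⟩ = a := fun a =>
    Subtype.ext (mul_right_identity_of_mem_ba hxe a.2)
  have hcl : e ∈ closure (NonUnitalAlgebra.adjoin ℂ {x} : Set A) := he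
  obtain ⟨p, hp, hep⟩ := Metric.mem_closure_iff.mp hcl 1 one_pos
  obtain ⟨q, hq, rfl⟩ := exists_eq_mul_of_mem_adjoin he hxe hp
  let E : ba x := ⟨e, he⟩
  let X : ba x := ⟨x, self_mem_ba x⟩
  let Q : ba x := ⟨q, hq⟩
  -- As E is the identity, a quasi-inverse y of X Q - E makes E + y the inverse of X Q; this avoids
  -- a unital ring structure on `ba x`.
  have hb : ‖X * Q - E‖ < 1 := by
    rw [norm_sub_rev]
    rwa [dist_eq_norm] at hep
  obtain ⟨y, -, hy⟩ := isQuasiregular_iff.mp (isQuasiregular_of_norm_lt_one hb)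
  have hy' : X * Q * (E + y) = E := by
    have h1 : X * Q = E + (X * Q - E) := by abel
    have h2 : y + (X * Q - E) + (X * Q - E) * y = 0 := by
      rw [mul_comm (X * Q - E) y, add_comm y, hy]
    rw [mul_add, hid]
    rw [sub_mul, mul_comm E y, hid] at h2
    calc X * Q + X * Q * y = E + (y + (X * Q - E) + (X * Q * y - y)) := by abel
      _ = E := by rw [h2, add_zero]
  refine ⟨E, Q * (E + y), fun a => ⟨?_, hid a⟩, ?_, ?_⟩
  · rw [mul_comm]
    exact hid a
  · rw [← mul_assoc]
    exact hy'
  · rw [mul_comm, ← mul_assoc]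
    exact hy'

/-- If some element of `ba x` is close to being an identity, then `ba x` has an identity. -/
theorem exists_identity_of_norm_sub_mul_le {x u : A} (hu : u ∈ ba x) {c : ℝ} (hc0 : 0 ≤ c)
    (hc : c < 1) (h : ∀ j ∈ ba x, ‖j - u * j‖ ≤ c * ‖j‖) : ∃ e ∈ ba x, x * e = x := by
  let U : ba x := ⟨u, hu⟩
  let T : ba x →L[ℂ] ba x := ContinuousLinearMap.mul ℂ (ba x) U
  have hT : ‖1 - T‖ < 1 :=
    (ContinuousLinearMap.opNorm_le_bound (1 - T) hc0 fun j => h j.1 j.2).trans_lt hc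
  have hunit : IsUnit T := by
    have := isUnit_one_sub_of_norm_lt_one hT
    rwa [sub_sub_cancel] at this
  obtain ⟨v, hv⟩ := hunit.exists_right_inv
  -- The candidate identity v U is the preimage of u under multiplication by u.
  have he : U * v U = U := congrArg (fun S : ba x →L[ℂ] ba x => S U) hv
  refine ⟨v U, (v U).2, ?_⟩
  have hue : u * (v U : A) = u := congrArg Subtype.val he
  -- Since c < 1, the hypothesis `h` makes multiplication by u injective on `ba x`.
  have hz : u * (x * (v U : A) - x) = 0 := by
    rw [mul_sub, ← mul_assoc, ba_mul_comm hu (self_mem_ba x), mul_assoc, hue, sub_self]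
  have hj := h (x * (v U : A) - x) (sub_mem (mul_mem (self_mem_ba x) (v U).2) (self_mem_ba x))
  rw [hz, sub_zero] at hj
  rw [← sub_eq_zero, ← norm_le_zero_iff]
  nlinarith [norm_nonneg (x * (v U : A) - x)]

/-- An operator with closed range is bounded below modulo its kernel. -/
theorem exists_preimage_norm_le_of_isClosed_range {E : Type*} [NormedAddCommGroup E]
    [NormedSpace ℂ E] [CompleteSpace E] (T : E →L[ℂ] E)
    (h : IsClosed (Set.range T)) : ∃ K > 0, ∀ a, ∃ b, T b = T a ∧ ‖b‖ ≤ K * ‖T a‖ := by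
  have h' : IsClosed (T.range : Set E) := h
  have : CompleteSpace T.range := h'.completeSpace_coe
  obtain ⟨K, hK, hb⟩ := ContinuousLinearMap.exists_preimage_norm_le T.rangeRestrict (by
    rintro ⟨_, a, rfl⟩
    exact ⟨a, rfl⟩)
  refine ⟨K, hK, fun a => ?_⟩
  obtain ⟨b, hb1, hb2⟩ := hb (T.rangeRestrict a)
  exact ⟨b, congrArg Subtype.val hb1, hb2⟩

end

noncomputable section

variable {A : Type u} [NonUnitalNormedRing A] [NormedSpace ℂ A] [IsScalarTower ℂ A A]
  [SMulCommClass ℂ A A]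

/-! ### Resolvents and roots of real positive elements -/

omit [IsScalarTower ℂ A A] [SMulCommClass ℂ A A] in
theorem norm_le_norm_smul_add_mul {x : A} (hx : x ∈ realPositive A) (s : ℝ) (a : A) :
    s * ‖a‖ ≤ ‖s • a + x * a‖ := by
  obtain ⟨B, _, _, _, _, φ, hφ, hxφ⟩ := hx
  have hn : ∀ a, ‖φ a‖ = ‖a‖ := fun a => hφ.norm_map_of_map_zero (map_zero φ) a
  have h := norm_le_of_accretive hxφ (s := s) (φ a)
  rwa [add_mul, ← Algebra.smul_def, ← map_mul, ← map_smul, ← map_add, hn, hn,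
    Complex.coe_smul] at h

/-- The algebra B that witnesses positivity in A also serves `ba x`. Resolvents and powers can thus
be formed inside `ba x` and identified with those of A by uniqueness. -/
theorem self_mem_realPositive_ba {x : A} (hx : x ∈ realPositive A) :
    (⟨x, self_mem_ba x⟩ : ba x) ∈ realPositive (ba x) := by
  obtain ⟨B, _, _, _, _, φ, hφ, hxφ⟩ := hx
  exact ⟨B, inferInstance, inferInstance, inferInstance, inferInstance,
    φ.comp (NonUnitalSubalgebraClass.subtype (ba x)), hφ.comp isometry_subtype_coe, hxφ⟩

variable [CompleteSpace A]

theorem smul_resolventMul_add {x : A} (hx : x ∈ realPositive A) {s : ℝ} (hs : 0 < s) :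
    s • resolventMul x s + x * resolventMul x s = x := by
  have h := inr_resolventMul (isUnit_add_of_realPositive hx hs)
  have h2 := congrArg (fun w => w.snd) h
  simpa [add_mul, Unitization.algebraMap_eq_inl] using h2

/-- Accretivity makes a ↦ s a + x a injective. -/
theorem eq_resolventMul {x : A} (hx : x ∈ realPositive A) {s : ℝ} (hs : 0 < s) {a : A}
    (ha : s • a + x * a = x) : a = resolventMul x s := by
  have h := norm_le_norm_smul_add_mul hx s (a - resolventMul x s)
  have h0 : s • (a - resolventMul x s) + x * (a - resolventMul x s) = 0 := by
    rw [smul_sub, mul_sub, sub_add_sub_comm, ha, smul_resolventMul_add hx hs, sub_self]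
  rw [h0, norm_zero] at h
  rw [← sub_eq_zero, ← norm_le_zero_iff]
  nlinarith [norm_nonneg (a - resolventMul x s)]

theorem resolventMul_mem_ba {x : A} (hx : x ∈ realPositive A) {s : ℝ} (hs : 0 < s) :
    resolventMul x s ∈ ba x := by
  have h := smul_resolventMul_add (self_mem_realPositive_ba hx) hs
  rw [← eq_resolventMul hx hs (congrArg Subtype.val h)]
  exact Subtype.property _

theorem mul_resolventMul {x : A} (hx : x ∈ realPositive A) {s : ℝ} (hs : 0 < s) :
    x * resolventMul x s = x - s • resolventMul x s :=
  eq_sub_of_add_eq' (smul_resolventMul_add hx hs)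

theorem resolventMul_mul {x : A} (hx : x ∈ realPositive A) {s : ℝ} (hs : 0 < s) :
    resolventMul x s * x = x - s • resolventMul x s := by
  rw [ba_mul_comm (resolventMul_mem_ba hx hs) (self_mem_ba x), mul_resolventMul hx hs]

theorem continuousOn_resolventMul {x : A} (hx : x ∈ realPositive A) :
    ContinuousOn (resolventMul x) (Set.Ioi 0) := by
  intro t ht
  have ht0 : (0 : ℝ) < t := ht
  rw [ContinuousWithinAt, tendsto_iff_norm_sub_tendsto_zero]
  have hlim : Filter.Tendsto (fun s : ℝ => |t - s| * 2 / t) (𝓝[Set.Ioi 0] t) (𝓝 0) := by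
    have : Continuous fun s : ℝ => |t - s| * 2 / t := by fun_prop
    have h := (this.tendsto t).mono_left (nhdsWithin_le_nhds (s := Set.Ioi 0))
    simpa using h
  refine squeeze_zero' (Filter.Eventually.of_forall fun _ => norm_nonneg _) ?_ hlim
  filter_upwards [self_mem_nhdsWithin] with s hs
  have hs0 : (0 : ℝ) < s := hs
  have h := norm_le_norm_smul_add_mul hx t (resolventMul x s - resolventMul x t)
  -- The resolvent identity; accretivity at t then gives the Lipschitz-type bound.
  have h0 : t • (resolventMul x s - resolventMul x t) +
      x * (resolventMul x s - resolventMul x t) = (t - s) • resolventMul x s := by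
    rw [mul_sub, mul_resolventMul hx hs0, mul_resolventMul hx ht0]
    module
  rw [h0, norm_smul, Real.norm_eq_abs] at h
  rw [le_div_iff₀ ht0, mul_comm]
  exact h.trans (mul_le_mul_of_nonneg_left (norm_resolventMul_le hx hs0).1 (abs_nonneg _))

open MeasureTheory in
theorem integrableOn_resolventMul_Ioc {x : A} (hx : x ∈ realPositive A) {r : ℝ} (hr : 0 < r) :
    IntegrableOn (fun s : ℝ => s ^ (r - 1) • resolventMul x s) (Set.Ioc 0 1) := by
  have hi : IntegrableOn (fun s : ℝ => 2 * s ^ (r - 1)) (Set.Ioc 0 1) := by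
    have := intervalIntegral.intervalIntegrable_rpow' (a := 0) (b := 1) (r := r - 1) (by linarith)
    rw [intervalIntegrable_iff_integrableOn_Ioc_of_le zero_le_one] at this
    exact this.const_mul 2
  refine hi.mono' ?_ ?_
  · refine ContinuousOn.aestronglyMeasurable ?_ measurableSet_Ioc
    have hc : ContinuousOn (fun s : ℝ => s ^ (r - 1)) (Set.Ioc 0 1) := fun s hs =>
      (Real.continuousAt_rpow_const _ _ (Or.inl hs.1.ne')).continuousWithinAt
    exact hc.smul ((continuousOn_resolventMul hx).mono fun s hs => hs.1)
  · refine (ae_restrict_iff' measurableSet_Ioc).mpr (Filter.Eventually.of_forall fun s hs => ?_)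
    have hp := Real.rpow_pos_of_pos hs.1 (r - 1)
    rw [norm_smul, Real.norm_of_nonneg hp.le, mul_comm]
    exact mul_le_mul_of_nonneg_right (norm_resolventMul_le hx hs.1).1 hp.le

theorem norm_rpow_smul_resolventMul_le {x : A} (hx : x ∈ realPositive A) (r : ℝ) {s : ℝ}
    (hs : 0 < s) : ‖s ^ (r - 1) • resolventMul x s‖ ≤ ‖x‖ * s ^ (r - 2) := by
  rw [norm_smul, Real.norm_of_nonneg (Real.rpow_pos_of_pos hs _).le]
  calc s ^ (r - 1) * ‖resolventMul x s‖ ≤ s ^ (r - 1) * (‖x‖ / s) := by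
        gcongr
        exact (norm_resolventMul_le hx hs).2
    _ = ‖x‖ * s ^ (r - 2) := by
      rw [show r - 2 = (r - 1) - 1 by ring, Real.rpow_sub_one hs.ne' (r - 1)]
      field_simp

open MeasureTheory in
theorem integrableOn_resolventMul_Ioi {x : A} (hx : x ∈ realPositive A) {r : ℝ} (hr : r < 1) :
    IntegrableOn (fun s : ℝ => s ^ (r - 1) • resolventMul x s) (Set.Ioi 1) := by
  have hi : IntegrableOn (fun s : ℝ => ‖x‖ * s ^ (r - 2)) (Set.Ioi 1) :=
    (integrableOn_Ioi_rpow_of_lt (by linarith) one_pos).const_mul _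
  have hpos : ∀ s ∈ Set.Ioi (1 : ℝ), 0 < s := fun s hs => one_pos.trans hs
  refine hi.mono' ?_ ?_
  · refine ContinuousOn.aestronglyMeasurable ?_ measurableSet_Ioi
    have hc : ContinuousOn (fun s : ℝ => s ^ (r - 1)) (Set.Ioi 1) := fun s hs =>
      (Real.continuousAt_rpow_const _ _ (Or.inl (hpos s hs).ne')).continuousWithinAt
    exact hc.smul ((continuousOn_resolventMul hx).mono hpos)
  · refine (ae_restrict_iff' measurableSet_Ioi).mpr (Filter.Eventually.of_forall fun s hs => ?_)
    exact norm_rpow_smul_resolventMul_le hx r (hpos s hs)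

open MeasureTheory in
-- On (0, 1], x u_s = x - s u_s with u_s = `resolventMul x s`: the first term integrates to x / r,
-- the second has integral of norm at most 2. On (1, ∞) the bound ‖u_s‖ ≤ ‖x‖ / s gives an integral
-- of norm at most ‖x‖ / (1 - r) ≤ 2‖x‖. The error is therefore a bounded factor times sin(rπ)/π,
-- which vanishes as r → 0.
theorem norm_mul_fracPow_sub_le {x : A} (hx : x ∈ realPositive A) {r : ℝ} (hr0 : 0 < r)
    (hr : r ≤ 1 / 2) : ‖x * fracPow x r - (Real.sin (r * Real.pi) / Real.pi * (1 / r)) • x‖ ≤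
      |Real.sin (r * Real.pi) / Real.pi| * (2 + 2 * ‖x‖ ^ 2) := by
  have hI1 := integrableOn_resolventMul_Ioc hx hr0
  have hI2 := integrableOn_resolventMul_Ioi hx (r := r) (by linarith)
  have hsplit : ∫ s in Set.Ioi (0 : ℝ), s ^ (r - 1) • resolventMul x s =
      (∫ s in Set.Ioc (0 : ℝ) 1, s ^ (r - 1) • resolventMul x s) +
        ∫ s in Set.Ioi (1 : ℝ), s ^ (r - 1) • resolventMul x s := by
    rw [← Set.Ioc_union_Ioi_eq_Ioi (zero_le_one (α := ℝ)),
      setIntegral_union (Set.Ioc_disjoint_Ioi le_rfl) measurableSet_Ioi hI1 hI2]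
  have hp : IntegrableOn (fun s : ℝ => s ^ (r - 1)) (Set.Ioc 0 1) := by
    have := intervalIntegral.intervalIntegrable_rpow' (a := 0) (b := 1) (r := r - 1) (by linarith)
    rwa [intervalIntegrable_iff_integrableOn_Ioc_of_le zero_le_one] at this
  have hval : ∫ s in Set.Ioc (0 : ℝ) 1, s ^ (r - 1) = 1 / r := by
    rw [← intervalIntegral.integral_of_le zero_le_one, integral_rpow (Or.inl (by linarith))]
    simp [hr0.ne']
  have hxI : IntegrableOn (fun s : ℝ => s ^ (r - 1) • x) (Set.Ioc 0 1) := hp.smul_const x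
  have hx1 : x * (∫ s in Set.Ioc (0 : ℝ) 1, s ^ (r - 1) • resolventMul x s) - (1 / r) • x =
      ∫ s in Set.Ioc (0 : ℝ) 1, -(s ^ r • resolventMul x s) := by
    have h1 := ((ContinuousLinearMap.mul ℂ A x).integral_comp_comm hI1).symm
    rw [ContinuousLinearMap.mul_apply'] at h1
    rw [h1, ← hval, ← integral_smul_const,
      ← integral_sub ((ContinuousLinearMap.mul ℂ A x).integrable_comp hI1) hxI]
    refine setIntegral_congr_fun measurableSet_Ioc fun s hs => ?_
    have h2 : s ^ r = s ^ (r - 1) * s := by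
      rw [← Real.rpow_add_one hs.1.ne', sub_add_cancel]
    simp only [ContinuousLinearMap.mul_apply', mul_smul_comm, mul_resolventMul hx hs.1]
    rw [h2]
    module
  have hb1 : ‖x * (∫ s in Set.Ioc (0 : ℝ) 1, s ^ (r - 1) • resolventMul x s) - (1 / r) • x‖ ≤
      2 := by
    rw [hx1]
    have := norm_setIntegral_le_of_norm_le_const (μ := volume) (s := Set.Ioc (0 : ℝ) 1) (C := 2)
      (f := fun s : ℝ => -(s ^ r • resolventMul x s)) (by simp) fun s hs => by
        rw [norm_neg, norm_smul, Real.norm_of_nonneg (Real.rpow_nonneg hs.1.le _)]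
        have h3 : s ^ r ≤ 1 := Real.rpow_le_one hs.1.le hs.2 hr0.le
        have h4 := (norm_resolventMul_le hx hs.1).1
        nlinarith [norm_nonneg (resolventMul x s)]
    simpa using this
  have hb2 : ‖∫ s in Set.Ioi (1 : ℝ), s ^ (r - 1) • resolventMul x s‖ ≤ 2 * ‖x‖ := by
    have hi : IntegrableOn (fun s : ℝ => ‖x‖ * s ^ (r - 2)) (Set.Ioi 1) :=
      (integrableOn_Ioi_rpow_of_lt (by linarith) one_pos).const_mul _
    refine (norm_integral_le_of_norm_le hi ?_).trans ?_
    · refine (ae_restrict_iff' measurableSet_Ioi).mpr (Filter.Eventually.of_forall fun s hs => ?_)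
      exact norm_rpow_smul_resolventMul_le hx r (one_pos.trans hs)
    · rw [integral_const_mul, integral_Ioi_rpow_of_lt (by linarith) one_pos, Real.one_rpow,
        show r - 2 + 1 = -(1 - r) by ring, neg_div_neg_eq, mul_comm]
      gcongr
      rw [div_le_iff₀ (by linarith)]
      linarith
  have heq : x * fracPow x r - (Real.sin (r * Real.pi) / Real.pi * (1 / r)) • x =
      (Real.sin (r * Real.pi) / Real.pi) •
        ((x * (∫ s in Set.Ioc (0 : ℝ) 1, s ^ (r - 1) • resolventMul x s) - (1 / r) • x) +
          x * ∫ s in Set.Ioi (1 : ℝ), s ^ (r - 1) • resolventMul x s) := by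
    rw [fracPow, hsplit, mul_smul_comm, mul_add]
    module
  rw [heq, norm_smul, Real.norm_eq_abs]
  refine mul_le_mul_of_nonneg_left ((norm_add_le _ _).trans (add_le_add hb1 ?_)) (abs_nonneg _)
  refine (norm_mul_le _ _).trans ?_
  nlinarith [norm_nonneg x]

theorem tendsto_mul_nthRoot {x : A} (hx : x ∈ realPositive A) :
    Filter.Tendsto (fun k : ℕ => x * nthRoot x (k + 1)) Filter.atTop (𝓝 x) := by
  let r : ℕ → ℝ := fun k => 1 / ((k : ℝ) + 1)
  have hr : Filter.Tendsto r Filter.atTop (𝓝 0) := tendsto_one_div_add_atTop_nhds_zero_nat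
  have hr0 : ∀ k, 0 < r k := fun k => by positivity
  have hr' : Filter.Tendsto r Filter.atTop (𝓝[≠] 0) :=
    tendsto_nhdsWithin_iff.mpr ⟨hr, Filter.Eventually.of_forall fun k => (hr0 k).ne'⟩
  let σ : ℝ → ℝ := fun t => Real.sin (t * Real.pi) / Real.pi
  have hσ0 : Filter.Tendsto (fun k => |σ (r k)| * (2 + 2 * ‖x‖ ^ 2)) Filter.atTop (𝓝 0) := by
    have hc : Continuous fun t => |σ t| * (2 + 2 * ‖x‖ ^ 2) := by
      simp only [σ]
      fun_prop
    have := (hc.tendsto 0).comp hr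
    simpa [σ, Function.comp_def] using this
  -- The limit of sin(rπ)/(rπ) is the derivative of σ at 0.
  have hσ1 : Filter.Tendsto (fun k => σ (r k) * (1 / r k)) Filter.atTop (𝓝 1) := by
    have hd : HasDerivAt σ 1 0 := by
      have h1 : HasDerivAt (fun t : ℝ => t * Real.pi) (1 * Real.pi) 0 :=
        (hasDerivAt_id' (0 : ℝ)).mul_const Real.pi
      have h2 := h1.sin.div_const Real.pi
      simpa [σ, Real.pi_ne_zero] using h2
    have h3 := (hasDerivAt_iff_tendsto_slope.mp hd).comp hr'
    refine h3.congr fun k => ?_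
    simp [slope, σ, mul_comm]
  have hmain : Filter.Tendsto
      (fun k : ℕ => x * nthRoot x (k + 1) - (σ (r k) * (1 / r k)) • x) Filter.atTop (𝓝 0) := by
    refine squeeze_zero_norm' ?_ hσ0
    -- For k ≥ 1 the exponent is at most 1/2 and the root is given by the integral, not by the
    -- special case n = 1.
    filter_upwards [Filter.eventually_ge_atTop 1] with k hk
    have hk1 : (1 : ℝ) ≤ k := by exact_mod_cast hk
    have h := norm_mul_fracPow_sub_le hx (hr0 k) (by
      simp only [r]
      rw [div_le_div_iff₀ (by positivity) (by norm_num)]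
      linarith)
    have hn : nthRoot x (k + 1) = fracPow x (r k) := by
      rw [nthRoot, if_neg (by omega)]
      push_cast
      rfl
    rw [hn]
    exact h
  have h := hmain.add (hσ1.smul_const x)
  simpa using h

/-- The integral can be computed in the Banach space `ba x`, since the isometric inclusion commutes
with it. -/
theorem fracPow_mem_ba {x : A} (hx : x ∈ realPositive A) (r : ℝ) : fracPow x r ∈ ba x := by
  let X : ba x := ⟨x, self_mem_ba x⟩
  let ι : ba x →ₗᵢ[ℂ] A := (ba x).toSubmodule.subtypeₗᵢ
  have h : fracPow x r = ((fracPow X r : ba x) : A) := by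
    refine congrArg ((Real.sin (r * Real.pi) / Real.pi) • · : A → A)
      (Eq.trans ?_ (ι.integral_comp_comm fun s : ℝ => s ^ (r - 1) • resolventMul X s))
    refine MeasureTheory.setIntegral_congr_fun measurableSet_Ioi fun s hs => ?_
    have hs0 : (0 : ℝ) < s := hs
    have hu := smul_resolventMul_add (self_mem_realPositive_ba hx) hs0
    exact congrArg (s ^ (r - 1) • · : A → A)
      (eq_resolventMul hx hs0 (congrArg Subtype.val hu)).symm
  rw [h]
  exact Subtype.property _

theorem nthRoot_mem_ba {x : A} (hx : x ∈ realPositive A) (n : ℕ) : nthRoot x n ∈ ba x := by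
  unfold nthRoot
  split_ifs
  · exact self_mem_ba x
  · exact fracPow_mem_ba hx _

end

noncomputable section

/-! ### Resolvents in the unitization -/

section Resolvent

variable {A : Type u} [NonUnitalNormedRing A] [NormedSpace ℂ A] [IsScalarTower ℂ A A]
  [SMulCommClass ℂ A A]

/-- The projection of the unitization, with the `ℓ¹` norm, onto the algebra. -/
def unitizationSnd (A : Type u) [NonUnitalNormedRing A] [NormedSpace ℂ A] [IsScalarTower ℂ A A]
    [SMulCommClass ℂ A A] : WithLp 1 (Unitization ℂ A) →L[ℂ] A :=
  LinearMap.mkContinuous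
    { toFun := fun w => (WithLp.ofLp w).snd
      map_add' := fun _ _ => rfl
      map_smul' := fun _ _ => rfl } 1 fun w => by
        rw [one_mul, WithLp.unitization_norm_def]
        exact le_add_of_nonneg_left (norm_nonneg _)

/-- The inclusion of the algebra in its unitization with the `ℓ¹` norm. -/
def unitizationInr (A : Type u) [NonUnitalNormedRing A] [NormedSpace ℂ A] [IsScalarTower ℂ A A]
    [SMulCommClass ℂ A A] : A →L[ℂ] WithLp 1 (Unitization ℂ A) :=
  LinearMap.mkContinuous
    { toFun := fun a => WithLp.toLp 1 (a : Unitization ℂ A)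
      map_add' := fun a b => by rw [Unitization.inr_add]; rfl
      map_smul' := fun c a => by rw [Unitization.inr_smul]; rfl } 1 fun a => by
        rw [one_mul]
        exact (WithLp.unitization_norm_inr a).le

theorem unitizationInr_mul (a b : A) :
    unitizationInr A (a * b) = unitizationInr A a * unitizationInr A b :=
  congrArg (WithLp.toLp 1) (Unitization.inr_mul ℂ a b)

/-- The element `(z - x)⁻¹ x` of `A`, computed in the unitization of `A`. -/
def resolventPart (x : A) (z : ℂ) : A :=
  unitizationSnd A (resolvent (unitizationInr A x) z * unitizationInr A x)

theorem isUnit_toLp_iff (w : Unitization ℂ A) :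
    IsUnit (WithLp.toLp 1 w : WithLp 1 (Unitization ℂ A)) ↔ IsUnit w :=
  ⟨fun h => h.map (WithLp.unitizationAlgEquiv (𝕜 := ℂ) (A := A) ℂ),
    fun h => h.map (WithLp.unitizationAlgEquiv (𝕜 := ℂ) (A := A) ℂ).symm⟩

theorem mem_resolventSet_of_isUnit {x : A} {z : ℂ}
    (h : IsUnit (algebraMap ℂ (Unitization ℂ A) z - (x : Unitization ℂ A))) :
    z ∈ resolventSet ℂ (unitizationInr A x) :=
  (isUnit_toLp_iff _).mpr h

theorem smul_resolventPart_sub {x : A} {z : ℂ}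
    (h : IsUnit (algebraMap ℂ (Unitization ℂ A) z - (x : Unitization ℂ A))) :
    z • resolventPart x z - x * resolventPart x z = x := by
  have h1 : (algebraMap ℂ _ z - unitizationInr A x) *
      (resolvent (unitizationInr A x) z * unitizationInr A x) = unitizationInr A x :=
    Ring.mul_inverse_cancel_left _ _ (mem_resolventSet_of_isUnit h)
  set w := resolvent (unitizationInr A x) z * unitizationInr A x with hw
  -- A multiple of x has no scalar part, so projecting to A loses nothing.
  have h0 : (WithLp.ofLp w).fst = 0 := by
    change (WithLp.ofLp (resolvent (unitizationInr A x) z)).fst * 0 = 0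
    rw [mul_zero]
  have h2 := congrArg (unitizationSnd A) h1
  have h3 : unitizationSnd A ((algebraMap ℂ _ z - unitizationInr A x) * w) =
      (z - 0) • (WithLp.ofLp w).snd + (WithLp.ofLp w).fst • (0 - x) +
        (0 - x) * (WithLp.ofLp w).snd := rfl
  rw [h3, h0, zero_smul, add_zero, sub_zero, zero_sub, neg_mul, ← sub_eq_add_neg] at h2
  exact h2

theorem eq_resolventPart {x : A} {z : ℂ}
    (h : IsUnit (algebraMap ℂ (Unitization ℂ A) z - (x : Unitization ℂ A))) {a : A}
    (ha : z • a - x * a = x) : a = resolventPart x z := by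
  have h0 : (algebraMap ℂ (Unitization ℂ A) z - (x : Unitization ℂ A)) *
      ((a - resolventPart x z : A) : Unitization ℂ A) = 0 := by
    have h1 : z • (a - resolventPart x z) - x * (a - resolventPart x z) = 0 := by
      rw [smul_sub, mul_sub, sub_sub_sub_comm, ha, smul_resolventPart_sub h, sub_self]
    rw [sub_mul, Unitization.algebraMap_eq_inl, Unitization.inl_mul_inr, ← Unitization.inr_mul,
      ← Unitization.inr_sub, h1, Unitization.inr_zero]
  rw [h.mul_right_eq_zero] at h0
  exact sub_eq_zero.mp (Unitization.inr_injective h0)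

theorem differentiableAt_resolventPart [CompleteSpace A] {x : A} {z : ℂ}
    (h : IsUnit (algebraMap ℂ (Unitization ℂ A) z - (x : Unitization ℂ A))) :
    DifferentiableAt ℂ (resolventPart x) z :=
  (unitizationSnd A).differentiableAt.comp z
    ((spectrum.hasDerivAt_resolvent_const_left (mem_resolventSet_of_isUnit h)).differentiableAt.mul_const _)

end Resolvent

/-! ### Circle integrals and the punctured disc -/

theorem map_circleIntegral {E F : Type*} [NormedAddCommGroup E] [NormedSpace ℂ E]
    [CompleteSpace E] [NormedAddCommGroup F] [NormedSpace ℂ F] [CompleteSpace F] (T : E →L[ℂ] F)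
    {f : ℂ → E} {c : ℂ} {R : ℝ} (hf : CircleIntegrable f c R) :
    T (∮ z in C(c, R), f z) = ∮ z in C(c, R), T (f z) := by
  simp only [circleIntegral]
  rw [← ContinuousLinearMap.intervalIntegral_comp_comm T hf.out]
  simp only [map_smul]

/-- For ε > 0 the punctured disc is the image under exp of the half-plane Re w < log ε. -/
theorem isPreconnected_punctured_ball (ε : ℝ) :
    IsPreconnected {z : ℂ | z ≠ 0 ∧ ‖z‖ < ε} := by
  rcases le_or_gt ε 0 with h | h
  · convert isPreconnected_empty
    ext z
    simp only [Set.mem_ofPred_eq, Set.mem_empty_iff_false, iff_false]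
    rintro ⟨-, h2⟩
    linarith [norm_nonneg z]
  · have hS : IsPreconnected (Complex.exp '' {w : ℂ | w.re < Real.log ε}) :=
      (convex_halfSpace_re_lt _).isPreconnected.image _ Complex.continuous_exp.continuousOn
    convert hS
    ext z
    constructor
    · rintro ⟨h1, h2⟩
      refine ⟨Complex.log z, ?_, Complex.exp_log h1⟩
      rw [Set.mem_ofPred_eq, Complex.log_re]
      exact Real.log_lt_log (norm_pos_iff.mpr h1) h2
    · rintro ⟨w, hw, rfl⟩
      refine ⟨Complex.exp_ne_zero w, ?_⟩
      rw [Complex.norm_exp, ← Real.lt_log_iff_exp_lt h]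
      exact hw

/-! ### Elements with isolated spectrum in a semisimple commutative algebra -/

section Semisimple

variable {C : Type u} [NonUnitalNormedCommRing C] [NormedSpace ℂ C] [IsScalarTower ℂ C C]
  [SMulCommClass ℂ C C] [CompleteSpace C]

/-- The unitization of a commutative algebra is commutative. -/
abbrev unitizationNormedCommRing (C : Type u) [NonUnitalNormedCommRing C] [NormedSpace ℂ C]
    [IsScalarTower ℂ C C] [SMulCommClass ℂ C C] :
    NormedCommRing (WithLp 1 (Unitization ℂ C)) where
  mul_comm v w := congrArg (WithLp.toLp 1) (mul_comm (WithLp.ofLp v) (WithLp.ofLp w))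

/-- An element at which all characters vanish is in the radical. -/
theorem isQuasiregular_mul_of_forall_map_eq_zero {c : C}
    (hc : ∀ ψ : C →L[ℂ] ℂ, (∀ a b, ψ (a * b) = ψ a * ψ b) → ψ c = 0) (b : C) :
    IsQuasiregular (b * c) := by
  let := unitizationNormedCommRing C
  rw [isQuasiregular_iff_isUnit' ℂ, ← isUnit_toLp_iff]
  by_contra h
  -- In a commutative complex Banach algebra a non-unit is killed by some character; its restriction
  -- to C is tested against c.
  obtain ⟨χ, hχ⟩ := WeakDual.CharacterSpace.exists_apply_eq_zero h
  let ψ : C →L[ℂ] ℂ := (WeakDual.toStrongDual (χ : WeakDual ℂ _)).comp (unitizationInr C)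
  have hψ : ∀ a, ψ a = χ (unitizationInr C a) := fun a => rfl
  have hmul : ∀ a b, ψ (a * b) = ψ a * ψ b := fun a b => by
    rw [hψ, hψ, hψ, unitizationInr_mul, map_mul]
  have h1 : χ (1 + unitizationInr C (b * c)) = 0 := hχ
  rw [map_add, map_one, ← hψ, hmul, hc ψ hmul, mul_zero, add_zero] at h1
  exact one_ne_zero h1

/-- With g(z) = (z - x)⁻¹x, one has x z⁻¹ g(z) = g(z) - z⁻¹x. Once ∮ g = 0 is known, integrating
leaves -2πi x, so a multiple of ∮ z⁻¹ g acts as an identity on x. -/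
theorem exists_identity_of_isolated (hC : IsSemisimple C) (x : C) {ε : ℝ} (hε : 0 < ε)
    (h : ∀ z : ℂ, z ≠ 0 → ‖z‖ < ε →
      IsUnit (algebraMap ℂ (Unitization ℂ C) z - (x : Unitization ℂ C))) :
    ∃ e : C, x * e = x := by
  have hr : 0 < ε / 2 := by positivity
  have hsph : ∀ z ∈ Metric.sphere (0 : ℂ) (ε / 2), z ≠ 0 ∧ ‖z‖ < ε := fun z hz => by
    rw [mem_sphere_zero_iff_norm] at hz
    exact ⟨norm_pos_iff.mp (hz ▸ hr), by linarith⟩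
  have hgc : ContinuousOn (resolventPart x) (Metric.sphere (0 : ℂ) (ε / 2)) := fun z hz =>
    (differentiableAt_resolventPart
      (h z (hsph z hz).1 (hsph z hz).2)).continuousAt.continuousWithinAt
  have hgi : CircleIntegrable (resolventPart x) 0 (ε / 2) := hgc.circleIntegrable hr.le
  have hic : ContinuousOn (fun z : ℂ => z⁻¹) (Metric.sphere (0 : ℂ) (ε / 2)) :=
    continuousOn_id.inv₀ fun z hz => (hsph z hz).1
  have hhi : CircleIntegrable (fun z => z⁻¹ • resolventPart x z) 0 (ε / 2) :=
    (hic.smul hgc).circleIntegrable hr.le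
  have hxi : CircleIntegrable (fun z : ℂ => z⁻¹ • x) 0 (ε / 2) :=
    (hic.smul continuousOn_const).circleIntegrable hr.le
  have hzero : (∮ z in C(0, ε / 2), resolventPart x z) = 0 := by
    -- A character ψ sends g(z) to ψ(x) / (z - ψ(x)); either ψ(x) = 0 or ψ(x) lies outside the disc
    -- of radius ε, and Cauchy's theorem gives 0.
    refine hC _ (isQuasiregular_mul_of_forall_map_eq_zero fun ψ hψ => ?_)
    rw [map_circleIntegral ψ hgi]
    have hval : ∀ z, z ≠ 0 → ‖z‖ < ε →
        z * ψ (resolventPart x z) - ψ x * ψ (resolventPart x z) = ψ x := fun z h0 h1 => by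
      rw [← hψ, ← smul_eq_mul, ← map_smul, ← map_sub, smul_resolventPart_sub (h z h0 h1)]
    by_cases ha : ψ x = 0
    · rw [circleIntegral.integral_congr hr.le (g := fun _ => (0 : ℂ)) fun z hz => ?_]
      · simp [circleIntegral]
      · have h2 := hval z (hsph z hz).1 (hsph z hz).2
        rw [ha, zero_mul, sub_zero] at h2
        exact (mul_eq_zero.mp h2).resolve_left (hsph z hz).1
    · have hfar : ε ≤ ‖ψ x‖ := by
        by_contra hlt
        have h2 := hval (ψ x) ha (not_le.mp hlt)
        rw [sub_self] at h2
        exact ha h2.symm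
      have hne : ∀ z ∈ Metric.closedBall (0 : ℂ) (ε / 2), z - ψ x ≠ 0 := fun z hz h2 => by
        rw [mem_closedBall_zero_iff, sub_eq_zero.mp h2] at hz
        linarith
      rw [circleIntegral.integral_congr hr.le (g := fun z => ψ x / (z - ψ x)) fun z hz => ?_]
      · refine Complex.circleIntegral_eq_zero_of_differentiable_on_off_countable hr.le
          Set.countable_empty ?_ fun z hz => ?_
        · exact continuousOn_const.div (continuousOn_id.sub continuousOn_const) hne
        · exact (differentiableAt_const _).div (differentiableAt_id.sub_const _)
            (hne z (Metric.ball_subset_closedBall hz.1))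
      · have h2 := hval z (hsph z hz).1 (hsph z hz).2
        change ψ (resolventPart x z) = _
        rw [eq_div_iff (hne z (Metric.sphere_subset_closedBall hz)), mul_comm, sub_mul, h2]
  have hmul : x * (∮ z in C(0, ε / 2), z⁻¹ • resolventPart x z) =
      -((2 * Real.pi * Complex.I : ℂ) • x) := by
    have h1 := map_circleIntegral (ContinuousLinearMap.mul ℂ C x) hhi
    rw [ContinuousLinearMap.mul_apply'] at h1
    rw [h1, circleIntegral.integral_congr hr.le
      (g := fun z => resolventPart x z - z⁻¹ • x) fun z hz => ?_,
      circleIntegral.integral_sub hgi hxi, hzero, circleIntegral.integral_smul_const]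
    · have h2 := circleIntegral.integral_sub_center_inv (0 : ℂ) hr.ne'
      simp only [sub_zero] at h2
      rw [h2, zero_sub]
    · have h2 := smul_resolventPart_sub (h z (hsph z hz).1 (hsph z hz).2)
      have h3 : x * resolventPart x z = z • resolventPart x z - x := by
        rw [eq_sub_iff_add_eq, ← eq_sub_iff_add_eq', h2]
      simp only [ContinuousLinearMap.mul_apply', mul_smul_comm]
      rw [h3, smul_sub, inv_smul_smul₀ (hsph z hz).1]
  refine ⟨-((2 * Real.pi * Complex.I : ℂ)⁻¹ •
    ∮ z in C(0, ε / 2), z⁻¹ • resolventPart x z), ?_⟩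
  rw [mul_neg, mul_smul_comm, hmul, smul_neg, neg_neg, inv_smul_smul₀ Complex.two_pi_I_ne_zero]

end Semisimple

/-! ### Spectra -/

section Spectrum

variable {A : Type u} [NonUnitalNormedRing A] [NormedSpace ℂ A] [IsScalarTower ℂ A A]
  [SMulCommClass ℂ A A]

/-- Since X kills 1 - E on both sides, z - X acts there as the scalar z; V and W supply one-sided
inverses on the part belonging to E. -/
theorem isUnit_algebraMap_sub {R : Type*} [Ring R] [Algebra ℂ R] {X E V W : R} {z : ℂ}
    (hz : z ≠ 0) (hXE : X * E = X) (hEX : E * X = X) (hV : (algebraMap ℂ R z - X) * V = E)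
    (hW : W * (algebraMap ℂ R z - X) = E) : IsUnit (algebraMap ℂ R z - X) := by
  have hE1 : (algebraMap ℂ R z - X) * (z⁻¹ • (1 - E)) = 1 - E := by
    rw [sub_mul, ← Algebra.smul_def, smul_inv_smul₀ hz, mul_smul_comm, mul_sub, mul_one, hXE,
      sub_self, smul_zero, sub_zero]
  have hE2 : (z⁻¹ • (1 - E)) * (algebraMap ℂ R z - X) = 1 - E := by
    rw [mul_sub, ← Algebra.commutes, ← Algebra.smul_def, smul_inv_smul₀ hz, smul_mul_assoc,
      sub_mul, one_mul, hEX, sub_self, smul_zero, sub_zero]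
  refine isUnit_iff_exists_and_exists.mpr ⟨⟨z⁻¹ • (1 - E) + V, ?_⟩, ⟨z⁻¹ • (1 - E) + W, ?_⟩⟩
  · rw [mul_add, hE1, hV, sub_add_cancel]
  · rw [add_mul, hE2, hW, sub_add_cancel]

theorem isUnit_algebraMap_sub_of_isUnit_one_sub {R : Type*} [Ring R] [Algebra ℂ R] {X Y E : R}
    {z : ℂ} (hz : z ≠ 0) (hXE : X * E = X) (hEX : E * X = X) (hEY : E * Y = Y) (hYE : Y * E = Y)
    (hXY : X * Y = E) (hYX : Y * X = E) (hu : IsUnit (1 - z • Y)) :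
    IsUnit (algebraMap ℂ R z - X) := by
  obtain ⟨v, hv1, hv2⟩ := isUnit_iff_exists.mp hu
  have hY1 : (algebraMap ℂ R z - X) * Y = -(E * (1 - z • Y)) := by
    rw [sub_mul, ← Algebra.smul_def, hXY, mul_sub, mul_one, mul_smul_comm, hEY, neg_sub]
  have hY2 : Y * (algebraMap ℂ R z - X) = -((1 - z • Y) * E) := by
    rw [mul_sub, ← Algebra.commutes, ← Algebra.smul_def, hYX, sub_mul, one_mul, smul_mul_assoc,
      hYE, neg_sub]
  refine isUnit_algebraMap_sub hz hXE hEX (V := -(Y * v)) (W := -(v * Y)) ?_ ?_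
  · rw [mul_neg, ← mul_assoc, hY1, neg_mul, neg_neg, mul_assoc, hv1, mul_one]
  · rw [neg_mul, mul_assoc, hY2, mul_neg, neg_neg, ← mul_assoc, hv2, one_mul]

/-- If λ + a is the inverse in the unitization, then λ e + a is the inverse in A. -/
theorem isInvertible_smul_sub_of_isUnit {x e : A} (he : IsIdentity e) {z : ℂ}
    (h : IsUnit (algebraMap ℂ (Unitization ℂ A) z - (x : Unitization ℂ A))) :
    IsInvertible (z • e - x) := by
  obtain ⟨w, hw1, hw2⟩ := isUnit_iff_exists.mp h
  have f1 : z * w.fst = 1 := by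
    have : (z - 0) * w.fst = 1 := congrArg (fun v => v.fst) hw1
    rwa [sub_zero] at this
  have s1 : z • w.snd - w.fst • x - x * w.snd = 0 := by
    have : (z - 0) • w.snd + w.fst • (0 - x) + (0 - x) * w.snd = 0 :=
      congrArg (fun v => v.snd) hw1
    rw [← this, zero_sub, neg_mul, smul_neg, sub_zero]
    abel
  have s2 : z • w.snd - w.fst • x - w.snd * x = 0 := by
    have : w.fst • (0 - x) + (z - 0) • w.snd + w.snd * (0 - x) = 0 :=
      congrArg (fun v => v.snd) hw2
    rw [← this, zero_sub, mul_neg, smul_neg, sub_zero]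
    abel
  refine ⟨e, w.fst • e + w.snd, he, ?_, ?_⟩
  · rw [sub_mul, mul_add, mul_add, smul_mul_smul_comm, (he e).1, f1, one_smul, smul_mul_assoc,
      (he _).1, mul_smul_comm, (he x).2]
    calc e + z • w.snd - (w.fst • x + x * w.snd) = e + (z • w.snd - w.fst • x - x * w.snd) := by
          abel
      _ = e := by rw [s1, add_zero]
  · rw [mul_sub, add_mul, add_mul, smul_mul_smul_comm, (he e).1, mul_comm, f1, one_smul,
      mul_smul_comm, (he _).2, smul_mul_assoc, (he x).1]
    calc e + z • w.snd - (w.fst • x + w.snd * x) = e + (z • w.snd - w.fst • x - w.snd * x) := by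
          abel
      _ = e := by rw [s2, add_zero]

/-- When A already has an identity, passing to the unitization can add only 0 to the spectrum. -/
theorem isUnit_of_notMem_Sp {x : A} {z : ℂ} (hz : z ≠ 0) (h : z ∉ Sp x) :
    IsUnit (algebraMap ℂ (Unitization ℂ A) z - (x : Unitization ℂ A)) := by
  simp only [Sp, Set.mem_ofPred_eq, not_or, not_exists, not_and, not_not] at h
  by_cases hA : ∃ e : A, IsIdentity e
  · obtain ⟨e, he⟩ := hA
    obtain ⟨e', y, he', hy1, hy2⟩ := h.1 e he
    have hee : e' = e := by rw [← (he e').1, (he' e).2]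
    subst hee
    have hY1 : (algebraMap ℂ (Unitization ℂ A) z - (x : Unitization ℂ A)) *
        (y : Unitization ℂ A) = e' := by
      rw [sub_mul, ← Algebra.smul_def, ← Unitization.inr_smul, ← Unitization.inr_mul,
        ← Unitization.inr_sub, ← hy1, sub_mul, smul_mul_assoc, (he y).1]
    have hY2 : (y : Unitization ℂ A) *
        (algebraMap ℂ (Unitization ℂ A) z - (x : Unitization ℂ A)) = e' := by
      rw [mul_sub, ← Algebra.commutes, ← Algebra.smul_def, ← Unitization.inr_smul,
        ← Unitization.inr_mul, ← Unitization.inr_sub, ← hy2, mul_sub, mul_smul_comm, (he y).2]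
    refine isUnit_algebraMap_sub hz ?_ ?_ hY1 hY2
    · rw [← Unitization.inr_mul, (he x).2]
    · rw [← Unitization.inr_mul, (he x).1]
  · exact spectrum.notMem_iff.mp (h.2 (not_exists.mp hA))

theorem isPseudoInvertible_of_zero_notMem_Sp {x : A} (h : (0 : ℂ) ∉ Sp x) :
    IsPseudoInvertible x := by
  simp only [Sp, Set.mem_ofPred_eq, not_or, not_exists, not_and, not_not] at h
  by_cases hA : ∃ e : A, IsIdentity e
  · obtain ⟨e, he⟩ := hA
    obtain ⟨e', y, he', hy1, -⟩ := h.1 e he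
    rw [zero_smul, zero_sub, neg_mul] at hy1
    exact ⟨-y, by rw [mul_neg, hy1, (he' x).1]⟩
  · have hu := spectrum.notMem_iff.mp (h.2 (not_exists.mp hA))
    -- An element of A has scalar part 0, so it is never a unit of the unitization.
    have := hu.map (Unitization.fstHom ℂ A)
    simp at this

variable [CompleteSpace A]

theorem zeroIsolatedOrAbsent_of_isInvertible {x : A}
    (h : IsInvertible (⟨x, self_mem_ba x⟩ : ba x)) : ZeroIsolatedOrAbsent (Sp x) := by
  obtain ⟨e, y, he, hxy, hyx⟩ := h
  have key : ∀ a b c : ba x, a * b = c →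
      ((a : A) : Unitization ℂ A) * ((b : A) : Unitization ℂ A) = ((c : A) : Unitization ℂ A) :=
    fun a b c habc => by
      rw [← Unitization.inr_mul]
      exact congrArg _ (congrArg Subtype.val habc)
  by_cases h0 : (0 : ℂ) ∈ Sp x
  swap
  · exact Or.inr h0
  -- This radius forces ‖z y‖ < 1; the added 1 keeps it positive when y = 0.
  refine Or.inl ⟨(‖(y : A)‖ + 1)⁻¹, by positivity, ?_⟩
  refine Set.eq_singleton_iff_unique_mem.mpr ⟨⟨h0, Metric.mem_ball_self (by positivity)⟩, ?_⟩
  rintro z ⟨hzS, hzb⟩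
  by_contra hz
  rw [mem_ball_zero_iff, lt_inv_comm₀ (norm_pos_iff.mpr hz) (by positivity)] at hzb
  have hb : ‖-(z • (y : A))‖ < 1 := by
    rw [norm_neg, norm_smul]
    have hzp := norm_pos_iff.mpr hz
    calc ‖z‖ * ‖(y : A)‖ < ‖z‖ * ‖z‖⁻¹ := by gcongr; linarith
      _ = 1 := mul_inv_cancel₀ hzp.ne'
  have hu : IsUnit (1 - z • ((y : A) : Unitization ℂ A)) := by
    have := isUnit_one_add_inr hb
    rwa [Unitization.inr_neg, Unitization.inr_smul, ← sub_eq_add_neg] at this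
  have hU := isUnit_algebraMap_sub_of_isUnit_one_sub hz (key _ _ _ (he _).2) (key _ _ _ (he _).1)
    (key _ _ _ (he y).1) (key _ _ _ (he y).2) (key _ _ _ hxy) (key _ _ _ hyx) hu
  rcases hzS with ⟨e', he', hn⟩ | ⟨-, hs⟩
  · exact hn (isInvertible_smul_sub_of_isUnit he' hU)
  · exact spectrum.notMem_iff.mpr hU hs

end Spectrum

end

noncomputable section

variable {A : Type u} [NonUnitalNormedRing A] [NormedSpace ℂ A] [IsScalarTower ℂ A A]
  [SMulCommClass ℂ A A]

/-- Hahn–Banach, applied in the quotient by the closed subspace `ba x`. -/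
theorem mem_ba_of_forall_dual {x a : A}
    (h : ∀ f : StrongDual ℂ A, (∀ b ∈ ba x, f b = 0) → f a = 0) : a ∈ ba x := by
  by_contra ha
  let M : Submodule ℂ A := (ba x).toSubmodule
  have hM : IsClosed (M : Set A) := ba_isClosed x
  have hne : M.mkQ a ≠ 0 := fun h0 => ha ((Submodule.Quotient.mk_eq_zero M).mp h0)
  obtain ⟨g, hg⟩ := SeparatingDual.exists_ne_zero (R := ℂ) hne
  refine hg (h (g.comp M.mkQL) fun b hb => ?_)
  have h0 : M.mkQ b = 0 := (Submodule.Quotient.mk_eq_zero M).mpr hb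
  change g (M.mkQ b) = 0
  rw [h0, map_zero]

variable [CompleteSpace A]

/-! ### Passing to the closed subalgebra generated by `x` -/

/-- For a functional f killing `ba x`, the function z ↦ f((z - x)⁻¹x) is holomorphic on the
connected punctured disc and vanishes on its negative radius, where accretivity puts the resolvent
in `ba x`. -/
theorem resolventPart_mem_ba {x : A} (hx : x ∈ realPositive A) {ε : ℝ}
    (h : ∀ z : ℂ, z ≠ 0 → ‖z‖ < ε →
      IsUnit (algebraMap ℂ (Unitization ℂ A) z - (x : Unitization ℂ A)))
    {z : ℂ} (hz : z ≠ 0) (hzε : ‖z‖ < ε) : resolventPart x z ∈ ba x := by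
  refine mem_ba_of_forall_dual fun f hf => ?_
  have hε : 0 < ε := (norm_nonneg z).trans_lt hzε
  have hopen : IsOpen {z : ℂ | z ≠ 0 ∧ ‖z‖ < ε} :=
    isOpen_ne.inter (isOpen_lt continuous_norm continuous_const)
  have han : AnalyticOnNhd ℂ (fun z => f (resolventPart x z)) {z : ℂ | z ≠ 0 ∧ ‖z‖ < ε} :=
    DifferentiableOn.analyticOnNhd (fun w hw =>
      (f.differentiableAt.comp w (differentiableAt_resolventPart
        (h w hw.1 hw.2))).differentiableWithinAt) hopen
  have hneg : ∀ s : ℝ, 0 < s → s < ε → f (resolventPart x (-(s : ℂ))) = 0 := fun s hs hsε => by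
    have hu := h (-(s : ℂ)) (by simpa using hs.ne') (by
      rwa [norm_neg, Complex.norm_real, Real.norm_of_nonneg hs.le])
    have he : -resolventMul x s = resolventPart x (-(s : ℂ)) := by
      refine eq_resolventPart hu ?_
      rw [neg_smul, smul_neg, neg_neg, mul_neg, sub_neg_eq_add, Complex.coe_smul,
        smul_resolventMul_add hx hs]
    rw [← he, map_neg, hf _ (resolventMul_mem_ba hx hs), neg_zero]
  have hlim : Filter.Tendsto (fun s : ℝ => -(s : ℂ)) (𝓝[≠] (ε / 2)) (𝓝[≠] (-((ε / 2 : ℝ) : ℂ))) := by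
    refine tendsto_nhdsWithin_iff.mpr ⟨?_, ?_⟩
    · have hc : Continuous fun s : ℝ => -(s : ℂ) := by fun_prop
      exact (hc.tendsto (ε / 2)).mono_left nhdsWithin_le_nhds
    · filter_upwards [self_mem_nhdsWithin] with s hs
      simpa only [Set.mem_compl_iff, Set.mem_singleton_iff, neg_inj, Complex.ofReal_inj] using hs
  have hev : ∀ᶠ s : ℝ in 𝓝[≠] (ε / 2), f (resolventPart x (-(s : ℂ))) = 0 := by
    refine Filter.Eventually.filter_mono nhdsWithin_le_nhds ?_
    filter_upwards [Ioo_mem_nhds (half_pos hε) (half_lt_self hε)] with s hs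
    exact hneg s hs.1 hs.2
  refine han.eqOn_zero_of_preconnected_of_frequently_eq_zero (isPreconnected_punctured_ball ε)
    (z₀ := -((ε / 2 : ℝ) : ℂ)) ⟨?_, ?_⟩ (hlim.frequently hev.frequently) ⟨hz, hzε⟩
  · rw [neg_ne_zero, Complex.ofReal_ne_zero]
    positivity
  · rw [norm_neg, Complex.norm_real, Real.norm_of_nonneg (half_pos hε).le]
    exact half_lt_self hε

theorem isUnit_sub_ba {x : A} (hx : x ∈ realPositive A) {ε : ℝ}
    (h : ∀ z : ℂ, z ≠ 0 → ‖z‖ < ε →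
      IsUnit (algebraMap ℂ (Unitization ℂ A) z - (x : Unitization ℂ A)))
    {z : ℂ} (hz : z ≠ 0) (hzε : ‖z‖ < ε) :
    IsUnit (algebraMap ℂ (Unitization ℂ (ba x)) z -
      ((⟨x, self_mem_ba x⟩ : ba x) : Unitization ℂ (ba x))) := by
  let X : ba x := ⟨x, self_mem_ba x⟩
  let g : ba x := ⟨resolventPart x z, resolventPart_mem_ba hx h hz hzε⟩
  have hg : z • g - X * g = X := Subtype.ext (smul_resolventPart_sub (h z hz hzε))
  -- From (z - X) g = X follows (z - X)(1 + g) = z.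
  refine IsUnit.of_mul_eq_one (z⁻¹ • (1 + (g : Unitization ℂ (ba x)))) ?_
  rw [mul_smul_comm, mul_add, mul_one, sub_mul _ _ (g : Unitization ℂ (ba x)),
    ← Algebra.smul_def z, ← Unitization.inr_smul, ← Unitization.inr_mul, ← Unitization.inr_sub, hg,
    sub_add_cancel, Algebra.algebraMap_eq_smul_one, inv_smul_smul₀ hz]

theorem isInvertible_of_isolated {x : A} (hx : x ∈ realPositive A) (hss : IsSemisimple (ba x))
    {ε : ℝ} (hε : 0 < ε) (h : ∀ z : ℂ, z ≠ 0 → ‖z‖ < ε →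
      IsUnit (algebraMap ℂ (Unitization ℂ A) z - (x : Unitization ℂ A))) :
    IsInvertible (⟨x, self_mem_ba x⟩ : ba x) := by
  let : NonUnitalNormedCommRing (ba x) :=
    { (inferInstance : NonUnitalNormedRing (ba x)) with
      mul_comm := fun a b => Subtype.ext (ba_mul_comm a.2 b.2) }
  obtain ⟨e, he⟩ := exists_identity_of_isolated hss (⟨x, self_mem_ba x⟩ : ba x) hε
    fun z hz hzε => isUnit_sub_ba hx h hz hzε
  exact isInvertible_of_identity e.2 (congrArg Subtype.val he)

/-! ### Closed ranges -/

/-- The error x - x u_s = s u_s has norm at most 2 s. -/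
theorem mem_closure_range_mul {x : A} (hx : x ∈ realPositive A) :
    x ∈ closure (Set.range fun a => x * a) ∩ closure (Set.range fun a => a * x) := by
  have key : ∀ δ > 0, ∃ s : ℝ, 0 < s ∧ ‖s • resolventMul x s‖ < δ := fun δ hδ => by
    have hs : 0 < δ / 4 := by positivity
    refine ⟨δ / 4, hs, ?_⟩
    rw [norm_smul, Real.norm_of_nonneg hs.le]
    nlinarith [(norm_resolventMul_le hx hs).1]
  constructor <;> refine Metric.mem_closure_iff.mpr fun δ hδ => ?_ <;>
    obtain ⟨s, hs, hsδ⟩ := key δ hδ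
  · refine ⟨_, ⟨resolventMul x s, rfl⟩, ?_⟩
    simpa only [dist_eq_norm, mul_resolventMul hx hs, sub_sub_cancel] using hsδ
  · refine ⟨_, ⟨resolventMul x s, rfl⟩, ?_⟩
    simpa only [dist_eq_norm, resolventMul_mul hx hs, sub_sub_cancel] using hsδ

theorem isInvertible_of_forall_factor {x : A} (hx : x ∈ realPositive A) {K : ℝ} (hK : 0 < K)
    (h : ∀ j ∈ ba x, ∃ b : A, ‖b‖ ≤ K * ‖j‖ ∧ (j = x * b ∨ j = b * x)) :
    IsInvertible (⟨x, self_mem_ba x⟩ : ba x) := by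
  -- With j = x b or j = b x, the defect j - u_s j has norm at most 2 s K ‖j‖; this s makes it ‖j‖ /
  -- 2.
  have hs : 0 < 1 / (4 * K) := by positivity
  have hsK : 1 / (4 * K) * 2 * K = 1 / 2 := by field_simp; norm_num
  set s := 1 / (4 * K)
  have hum := resolventMul_mem_ba hx hs
  have hu := (norm_resolventMul_le hx hs).1
  have hbound : ∀ b j : A, ‖b‖ ≤ K * ‖j‖ → s * (‖resolventMul x s‖ * ‖b‖) ≤ 1 / 2 * ‖j‖ :=
    fun b j hb => by
      calc s * (‖resolventMul x s‖ * ‖b‖) ≤ s * (2 * (K * ‖j‖)) := by gcongr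
        _ = (s * 2 * K) * ‖j‖ := by ring
        _ = 1 / 2 * ‖j‖ := by rw [hsK]
  obtain ⟨e, he, hxe⟩ := exists_identity_of_norm_sub_mul_le hum (c := 1 / 2) (by norm_num)
    (by norm_num) fun j hj => by
      obtain ⟨b, hb, hjb⟩ := h j hj
      have hbd := hbound b j hb
      rcases hjb with hjb | hjb
      · have h1 : j - resolventMul x s * j = s • (resolventMul x s * b) := by
          rw [hjb, ← mul_assoc, resolventMul_mul hx hs, sub_mul, sub_sub_cancel, smul_mul_assoc]
        rw [h1, norm_smul, Real.norm_of_nonneg hs.le]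
        exact (mul_le_mul_of_nonneg_left (norm_mul_le _ _) hs.le).trans hbd
      · have h1 : j - resolventMul x s * j = s • (b * resolventMul x s) := by
          rw [ba_mul_comm hum hj, hjb, mul_assoc, mul_resolventMul hx hs, mul_sub, sub_sub_cancel,
            mul_smul_comm]
        rw [h1, norm_smul, Real.norm_of_nonneg hs.le]
        refine (mul_le_mul_of_nonneg_left (norm_mul_le _ _) hs.le).trans ?_
        rwa [mul_comm ‖b‖]
  exact isInvertible_of_identity he hxe

/-- A closed xA is a closed subalgebra containing x, hence contains `ba x`; the open mapping theorem
bounds the factors uniformly. -/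
theorem isInvertible_of_isClosed_range_mul_left {x : A} (hx : x ∈ realPositive A)
    (h : IsClosed (Set.range fun a : A => x * a)) :
    IsInvertible (⟨x, self_mem_ba x⟩ : ba x) := by
  obtain ⟨K, hK, hb⟩ := exists_preimage_norm_le_of_isClosed_range (ContinuousLinearMap.mul ℂ A x) h
  let S : NonUnitalSubalgebra ℂ A :=
    { carrier := Set.range fun a : A => x * a
      add_mem' := by
        rintro _ _ ⟨a, rfl⟩ ⟨b, rfl⟩
        exact ⟨a + b, mul_add _ _ _⟩
      zero_mem' := ⟨0, mul_zero x⟩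
      mul_mem' := by
        rintro _ _ ⟨a, rfl⟩ ⟨b, rfl⟩
        exact ⟨a * (x * b), (mul_assoc _ _ _).symm⟩
      smul_mem' := by
        rintro c _ ⟨a, rfl⟩
        exact ⟨c • a, mul_smul_comm _ _ _⟩ }
  have hxS : x ∈ S := by
    have := (mem_closure_range_mul hx).1
    rwa [h.closure_eq] at this
  have hle : ba x ≤ S := NonUnitalAlgebra.elemental.le_of_mem (s := S) h hxS
  refine isInvertible_of_forall_factor hx hK fun j hj => ?_
  obtain ⟨a, rfl⟩ := hle hj
  obtain ⟨b, hb1, hb2⟩ := hb a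
  exact ⟨b, hb2, Or.inl hb1.symm⟩

theorem isInvertible_of_isClosed_range_mul_right {x : A} (hx : x ∈ realPositive A)
    (h : IsClosed (Set.range fun a : A => a * x)) :
    IsInvertible (⟨x, self_mem_ba x⟩ : ba x) := by
  obtain ⟨K, hK, hb⟩ :=
    exists_preimage_norm_le_of_isClosed_range ((ContinuousLinearMap.mul ℂ A).flip x) h
  let S : NonUnitalSubalgebra ℂ A :=
    { carrier := Set.range fun a : A => a * x
      add_mem' := by
        rintro _ _ ⟨a, rfl⟩ ⟨b, rfl⟩
        exact ⟨a + b, add_mul _ _ _⟩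
      zero_mem' := ⟨0, zero_mul x⟩
      mul_mem' := by
        rintro _ _ ⟨a, rfl⟩ ⟨b, rfl⟩
        exact ⟨a * x * b, mul_assoc _ _ _⟩
      smul_mem' := by
        rintro c _ ⟨a, rfl⟩
        exact ⟨c • a, smul_mul_assoc _ _ _⟩ }
  have hxS : x ∈ S := by
    have := (mem_closure_range_mul hx).2
    rwa [h.closure_eq] at this
  have hle : ba x ≤ S := NonUnitalAlgebra.elemental.le_of_mem (s := S) h hxS
  refine isInvertible_of_forall_factor hx hK fun j hj => ?_
  obtain ⟨a, rfl⟩ := hle hj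
  obtain ⟨b, hb1, hb2⟩ := hb a
  exact ⟨b, hb2, Or.inr hb1.symm⟩

omit [IsScalarTower ℂ A A] [SMulCommClass ℂ A A] [NormedSpace ℂ A] [CompleteSpace A] in
-- The range is the fixed-point set of left multiplication by x y.
theorem isClosed_range_mul_left_of_isPseudoInvertible {x : A} (h : IsPseudoInvertible x) :
    IsClosed (Set.range fun a : A => x * a) := by
  obtain ⟨y, hy⟩ := h
  have heq : (Set.range fun a : A => x * a) = {a | x * y * a = a} := by
    ext a
    constructor
    · rintro ⟨b, rfl⟩
      change x * y * (x * b) = x * b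
      rw [← mul_assoc, hy]
    · intro ha
      exact ⟨y * a, (mul_assoc _ _ _).symm.trans ha⟩
  rw [heq]
  exact isClosed_eq (continuous_const.mul continuous_id) continuous_id

omit [IsScalarTower ℂ A A] [SMulCommClass ℂ A A] [NormedSpace ℂ A] [CompleteSpace A] in
theorem isClosed_range_mul_right_of_isPseudoInvertible {x : A} (h : IsPseudoInvertible x) :
    IsClosed (Set.range fun a : A => a * x) := by
  obtain ⟨y, hy⟩ := h
  have heq : (Set.range fun a : A => a * x) = {a | a * (y * x) = a} := by
    ext a
    constructor
    · rintro ⟨b, rfl⟩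
      change b * x * (y * x) = b * x
      rw [mul_assoc, ← mul_assoc x, hy]
    · intro ha
      exact ⟨a * y, (mul_assoc _ _ _).trans ha⟩
  rw [heq]
  exact isClosed_eq (continuous_id.mul continuous_const) continuous_id

omit [CompleteSpace A] in
theorem isPseudoInvertible_of_isInvertible {x : A}
    (h : IsInvertible (⟨x, self_mem_ba x⟩ : ba x)) : IsPseudoInvertible x := by
  obtain ⟨e, y, he, hxy, -⟩ := h
  refine ⟨y, ?_⟩
  have h1 := (he ⟨x, self_mem_ba x⟩).1
  rw [← hxy] at h1
  exact congrArg Subtype.val h1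

/-! ### The support idempotent -/

theorem isInvertible_of_support_mem_range {L : StrongDual ℂ (ℕ →ᵇ ℂ)} (hL : IsBanachLimit L)
    {x : A} (hx : x ∈ realPositive A)
    (h : support L hx ∈ Set.range (NormedSpace.inclusionInDoubleDual ℂ A)) :
    IsInvertible (⟨x, self_mem_ba x⟩ : ba x) := by
  obtain ⟨e, he⟩ := h
  have hf : ∀ f : StrongDual ℂ A, f e = L (rootSeq hx f) := fun f =>
    congrArg (fun F : StrongDual ℂ (StrongDual ℂ A) => F f) he
  have hmem : e ∈ ba x := mem_ba_of_forall_dual fun f h0 => by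
    rw [hf]
    refine hL.eq_lim _ 0 (tendsto_const_nhds.congr fun k => ?_)
    exact (h0 _ (nthRoot_mem_ba hx (k + 1))).symm
  refine isInvertible_of_identity hmem ?_
  refine (SeparatingDual.eq_iff_forall_dual_eq (R := ℂ)).mpr fun f => ?_
  -- Testing against a ↦ f(x a) turns x x^{1/n} → x into f(x e) = f(x).
  have h1 := hf (f.comp (ContinuousLinearMap.mul ℂ A x))
  have h2 : L (rootSeq hx (f.comp (ContinuousLinearMap.mul ℂ A x))) = f x :=
    hL.eq_lim _ _ ((f.continuous.tendsto x).comp (tendsto_mul_nthRoot hx))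
  exact h1.trans h2

theorem support_mem_range_of_isInvertible {L : StrongDual ℂ (ℕ →ᵇ ℂ)} (hL : IsBanachLimit L)
    {x : A} (hx : x ∈ realPositive A) (h : IsInvertible (⟨x, self_mem_ba x⟩ : ba x)) :
    support L hx ∈ Set.range (NormedSpace.inclusionInDoubleDual ℂ A) := by
  obtain ⟨e, y, he, hxy, -⟩ := h
  have hxy' : x * (y : A) = e := congrArg Subtype.val hxy
  have hlim : Filter.Tendsto (fun k : ℕ => nthRoot x (k + 1)) Filter.atTop (𝓝 (e : A)) := by
    rw [← hxy']
    -- Each root r satisfies r = r e = (x r) y, and x r → x.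
    refine ((tendsto_mul_nthRoot hx).mul_const (y : A)).congr fun k => ?_
    have hk := nthRoot_mem_ba hx (k + 1)
    rw [ba_mul_comm (self_mem_ba x) hk, mul_assoc, hxy']
    exact congrArg Subtype.val (he ⟨_, hk⟩).2
  refine ⟨e, ContinuousLinearMap.ext fun f => ?_⟩
  exact (hL.eq_lim (rootSeq hx f) _ ((f.continuous.tendsto _).comp hlim)).symm

theorem tfae_isInvertible {L : StrongDual ℂ (ℕ →ᵇ ℂ)} (hL : IsBanachLimit L)
    {x : A} (hx : x ∈ realPositive A) :
    List.TFAE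
      [support L hx ∈ Set.range (NormedSpace.inclusionInDoubleDual ℂ A),
        IsClosed (Set.range fun a : A => x * a),
        IsClosed (Set.range fun a : A => a * x),
        IsPseudoInvertible x,
        IsInvertible (⟨x, self_mem_ba x⟩ : ba x)] := by
  tfae_have 1 → 5 := isInvertible_of_support_mem_range hL hx
  tfae_have 5 → 1 := support_mem_range_of_isInvertible hL hx
  tfae_have 5 → 4 := isPseudoInvertible_of_isInvertible
  tfae_have 4 → 2 := isClosed_range_mul_left_of_isPseudoInvertible
  tfae_have 4 → 3 := isClosed_range_mul_right_of_isPseudoInvertible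
  tfae_have 2 → 5 := isInvertible_of_isClosed_range_mul_left hx
  tfae_have 3 → 5 := isInvertible_of_isClosed_range_mul_right hx
  tfae_finish

theorem isInvertible_of_zeroIsolatedOrAbsent {x : A} (hx : x ∈ realPositive A)
    (hss : IsSemisimple (ba x)) (h : ZeroIsolatedOrAbsent (Sp x)) :
    IsInvertible (⟨x, self_mem_ba x⟩ : ba x) := by
  rcases h with ⟨ε, hε, h⟩ | h
  · refine isInvertible_of_isolated hx hss hε fun z hz hzε => isUnit_of_notMem_Sp hz fun hzS => hz ?_
    have : z ∈ Sp x ∩ Metric.ball 0 ε := ⟨hzS, mem_ball_zero_iff.mpr hzε⟩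
    rwa [h] at this
  · exact isInvertible_of_isClosed_range_mul_left hx
      (isClosed_range_mul_left_of_isPseudoInvertible (isPseudoInvertible_of_zero_notMem_Sp h))

end

end RealPos

theorem theorem7 {A : Type u} [NonUnitalNormedRing A] [NormedSpace ℂ A] [IsScalarTower ℂ A A]
    [SMulCommClass ℂ A A] [CompleteSpace A]
    (L : StrongDual ℂ (BoundedContinuousFunction ℕ ℂ)) (hL : RealPos.IsBanachLimit L)
    (x : A) (hx : x ∈ RealPos.realPositive A) :
    List.TFAE
      [RealPos.support L hx ∈ Set.range (NormedSpace.inclusionInDoubleDual ℂ A),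
        IsClosed (Set.range fun a : A => x * a),
        IsClosed (Set.range fun a : A => a * x),
        RealPos.IsPseudoInvertible x,
        RealPos.IsInvertible
          (⟨x, NonUnitalAlgebra.elemental.self_mem ℂ x⟩ : RealPos.ba x)] ∧
    (RealPos.IsInvertible (⟨x, NonUnitalAlgebra.elemental.self_mem ℂ x⟩ : RealPos.ba x) →
      RealPos.ZeroIsolatedOrAbsent (RealPos.Sp x)) ∧
    (RealPos.IsSemisimple (RealPos.ba x) →
      List.TFAE
        [RealPos.support L hx ∈ Set.range (NormedSpace.inclusionInDoubleDual ℂ A),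
          IsClosed (Set.range fun a : A => x * a),
          IsClosed (Set.range fun a : A => a * x),
          RealPos.IsPseudoInvertible x,
          RealPos.IsInvertible
            (⟨x, NonUnitalAlgebra.elemental.self_mem ℂ x⟩ : RealPos.ba x),
          RealPos.ZeroIsolatedOrAbsent (RealPos.Sp x)]) := by
  have key := RealPos.tfae_isInvertible hL hx
  refine ⟨key, RealPos.zeroIsolatedOrAbsent_of_isInvertible, fun hss => ?_⟩
  tfae_have 1 ↔ 5 := key.out 0 4
  tfae_have 2 ↔ 5 := key.out 1 4
  tfae_have 3 ↔ 5 := key.out 2 4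
  tfae_have 4 ↔ 5 := key.out 3 4
  tfae_have 5 → 6 := RealPos.zeroIsolatedOrAbsent_of_isInvertible
  tfae_have 6 → 5 := RealPos.isInvertible_of_zeroIsolatedOrAbsent hx hss
  tfae_finish
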